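/- **Time complexity of sequential Monte Carlo (SMC) with the optimal proposal.** *Setting.* Let $\mathcal S_0$ be a prompt space and $\mathcal S_1,\mathcal S_2,\dots$ discrete state spaces; put $\mathcal S_{1:0}=\{\varnothing\}$ and $\mathcal S_{1:t}=\mathcal S_{1:t-1}\times\mathcal S_t$. Fix a prompt $s_0$, a base model $\pi_{\rm ref}(\cdot\mid s_0,s_{1:t})$ (a probability law on $\mathcal S_{t+1}$ for each prefix $s_{1:t}$), a reward model $\hat V(s_0,s_{1:t})>0$ on prefixes, and a horizon $T\ge1$. The target is $\tilde\pi_T(s_{1:T})\propto\pi_{\rm ref}(s_{1:T}\mid s_0)\,\hat V(s_0,s_{1:T})$. Write $Z(s_{1:t})=\mathbb E_{s_{t+1}\sim\pi_{\rm ref}(\cdot\mid s_0,s_{1:t})}[\hat V(s_0,s_{1:t+1})]$. Assume that for all $0\le t<T$ and all $s_{1:t+1}$: 1. (ratio bound) $\max\big\{\hat V(s_0,s_{1:t})/\hat V(s_0,s_{1:t+1}),\ \hat V(s_0,s_{1:t+1})/\hat V(s_0,s_{1:t})\big\}\le L$ (so $L\ge1$); 2. (Bellman error bound) $\max\big\{\hat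 V(s_0,s_{1:t})/Z(s_{1:t}),\ Z(s_{1:t})/\hat V(s_0,s_{1:t})\big\}\le1+\varepsilon$, where $\varepsilon\ge0$. *Rejection sampling.* Given a score $g\ge0$, a law $\mu$, a threshold $M$ and a failure probability $\delta'$, let $n=\lceil 4M\log(4/\delta')\rceil$ and let $\widehat Z$ be the mean of $g$ over $n$ i.i.d. draws from $\mu$. Then make at most $n$ independent trials: draw $z\sim\mu$ and accept it with probability $\min\{g(z)/(M\widehat Z),1\}$. Return the first accepted $z$; if none is accepted, return a fresh draw from $\mu$. *Sampler.* It has parameters $N,N_m\ge1$, $M>0$ and $\delta'$, and starts with $N$ empty prefixes. For $t=0,\dots,T-1$, given particles $x_1,\dots,x_N\in\mathcal S_{1:t}$: - (propagate) for each $i$, draw $y_i$ by rejection sampling with score $\hat V(s_0,(x_i,\cdot))$, law $\pi_{\rm ref}(\cdot\mid s_0,x_i)$ and parameters $M,\delta'$; - (weights) for each $j$, let $\widehat Z_j$ be the mean of $\hat V(s_0,(x_j,\cdot))$ over $N_m$ fresh i.i.d. draws from $\pi_{\rm ref}(\cdot\mid s_0,x_j)$, and put $w_j=\widehat Z_j/\hat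 V(s_0,x_j)$; - (resample) draw indices $A_1,\dots,A_N$ i.i.d. with $\mathbb P(A_i=j)=w_j/\sum_\ell w_\ell$; the new particles are $(x_{A_i},y_{A_i})$, $i=1,\dots,N$. After the last round it outputs one of the $N$ particles, chosen uniformly at random. All draws are independent given the past. The *time* of a run counts one unit for each draw from the base model, evaluation of $\hat V$, accept/reject coin, weight, and drawn index. $\hat\pi_T|_{\mathcal E}$ denotes the law of the output conditioned on an event $\mathcal E$, and $\|\cdot\|_{\rm TV}$ is the total variation distance $\frac12\sum|\cdot|$. *Claim.* For all constants $c_1,c_2,c_3>0$ there are constants $C>0$, $K\ge1$, $k\in\mathbb N$, depending only on $c_1,c_2,c_3$, such that the following holds. Let $T\ge1$, $L\ge1$, $0\le\varepsilon\le c_1/T$, $0<\delta_{\rm TV}\le c_2$, $0<\delta\le\min\{c_3\delta_{\rm TV},\tfrac12\}$. Then there are $N,N_m\ge1$ and $M>0$, depending only on these numbers and not on the spaces, $\pi_{\rm ref}$, $\hat V$ or $s_0$, such that for every model satisfying 1 and 2 the sampler with $\delta'=\delta/(KNT)$ has the following two properties: every run takes time at most $$C\Big(1+\log\big(1+\tfrac{T}{\delta_{\rm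 TV}}\big)\Big)^{k}\Big(\frac{\varepsilon L T^5}{\delta_{\rm TV}^3}+LT\Big)\log\frac1\delta ,$$ and there is an event $\mathcal E$ with $\mathbb P(\mathcal E)\ge1-\delta$ and $\|\tilde\pi_T-\hat\pi_T|_{\mathcal E}\|_{\rm TV}\le\delta_{\rm TV}$. In particular, the time is $\tilde O\big(\varepsilon LT^5\log(\delta^{-1})/\delta_{\rm TV}^3\big)$ as soon as $\varepsilon T^4\ge\delta_{\rm TV}^3$. -/

import Mathlib

open scoped ENNReal NNReal

universe u v

noncomputable section

namespace OptSMC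

/-! ### Elementary random choices -/

/-- The law of a vector of independent variables with laws `p 0, …, p (n-1)`. -/
def indep {α : Type v} : (n : ℕ) → (Fin n → PMF α) → PMF (Fin n → α)
  | 0, _ => PMF.pure Fin.elim0
  | n + 1, p => (p 0).bind fun x => (indep n fun i => p i.succ).map fun xs => Fin.cons x xs

/-- The probability law proportional to the weights `w`. The law `fallback` is used only when the
weights cannot be normalized (total weight `0` or `∞`). -/
def normalizeOr {α : Type v} (fallback : PMF α) (w : α → ℝ≥0∞) : PMF α :=
  open Classical in
  if h : (∑' a, w a) ≠ 0 ∧ (∑' a, w a) ≠ ∞ then PMF.normalize w h.1 h.2 else fallback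

/-- The tilted law `ν(a) ∝ μ(a) g(a)`. -/
def tilt {α : Type v} (μ : PMF α) (g : α → ℝ) : PMF α :=
  normalizeOr μ fun a => μ a * ENNReal.ofReal (g a)

/-- The categorical law on `{0, …, N-1}` with probabilities proportional to `w`. -/
def categorical {N : ℕ} [NeZero N] (w : Fin N → ℝ) : PMF (Fin N) :=
  normalizeOr (PMF.uniformOfFintype (Fin N)) fun j => ENNReal.ofReal (w j)

/-- A Bernoulli variable with success probability `min {p, 1}` (for `p ≥ 0`). -/
def coin (p : ℝ) : PMF Bool :=
  PMF.bernoulli (min p.toNNReal 1) (min_le_right _ _)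

/-- Total variation distance of two discrete laws. -/
def tvDist {α : Type v} (μ ν : PMF α) : ℝ :=
  (1 / 2) * ∑' a, |(μ a).toReal - (ν a).toReal|

/-! ### Rejection sampling -/

/-- Everything drawn in one call of rejection sampling with trial budget `n`: the draws for the
empirical normalizer, the trials (proposal, accept bit), and the draw for the failure case. All
trials are recorded; those after the first acceptance are not executed, hence not charged in
`RSRun.time`. -/
structure RSRun (α : Type v) (n : ℕ) : Type v where
  norm : Fin n → α
  trial : Fin n → α × Bool
  last : α

namespace RSRun
variable {α : Type v} {n : ℕ}

/-- Index of the first accepted trial, if there is one. -/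
def firstAccept (r : RSRun α n) : Option (Fin n) :=
  (List.finRange n).find? fun i => (r.trial i).2

/-- The returned sample. -/
def out (r : RSRun α n) : α :=
  match r.firstAccept with
  | some i => (r.trial i).1
  | none => r.last

/-- Unit cost for each base draw, each evaluation of the score, and each coin. -/
def time (r : RSRun α n) : ℕ :=
  2 * n + match r.firstAccept with
    | some i => 3 * ((i : ℕ) + 1)
    | none => 3 * n + 1

end RSRun

/-- The trial budget `4 M log (4 / δ)`, rounded up. -/
def rsBudget (M δ : ℝ) : ℕ := ⌈4 * M * Real.log (4 / δ)⌉₊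

/-- Rejection sampling for the law `∝ g μ`, with threshold `M` and trial budget `n`: estimate the
normalizer by the mean `Ẑ` of `n` scores, then accept a proposal `z ∼ μ` with probability
`min {g z / (M Ẑ), 1}`, at most `n` times; if nothing is accepted, return a fresh draw of `μ`. -/
def rejectionSampling {α : Type v} (g : α → ℝ) (μ : PMF α) (M : ℝ) (n : ℕ) : PMF (RSRun α n) :=
  (indep n fun _ => μ).bind fun zs =>
    (indep n fun _ => μ.bind fun z =>
      (coin (g z / (M * ((∑ i, g (zs i)) / n)))).map fun b => (z, b)).bind fun tr =>
        μ.map fun z => ⟨zs, tr, z⟩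

/-! ### Reasoning model -/

/-- The prefix space `S_{1:t} = S_{1:t-1} × S_t`, with `S_{1:0}` a point. (`S 0` is the space of
prompts.) -/
def Pref (S : ℕ → Type u) : ℕ → Type u
  | 0 => PUnit
  | t + 1 => Pref S t × S (t + 1)

/-- The base model `π_ref(s_{t+1} | s_0, s_{1:t})` and the reward model `V(s_0, s_{1:t})`. -/
structure Model (S : ℕ → Type u) where
  ref : S 0 → (t : ℕ) → Pref S t → PMF (S (t + 1))
  V : S 0 → (t : ℕ) → Pref S t → ℝ

namespace Model
variable {S : ℕ → Type u}

/-- The law `π_ref(s_{1:t} | s_0)` of a prefix under the base model. -/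
def refLaw (m : Model S) (s₀ : S 0) : (t : ℕ) → PMF (Pref S t)
  | 0 => PMF.pure PUnit.unit
  | t + 1 => (m.refLaw s₀ t).bind fun x => (m.ref s₀ t x).map fun y => (x, y)

/-- The target `π̃_t(s_{1:t} | s_0) ∝ π_ref(s_{1:t} | s_0) V(s_0, s_{1:t})`. -/
def target (m : Model S) (s₀ : S 0) (t : ℕ) : PMF (Pref S t) :=
  tilt (m.refLaw s₀ t) (m.V s₀ t)

/-- `V(s_0, (s_{1:t}, ·))` as a function of the next state. -/
def nextV (m : Model S) (s₀ : S 0) (t : ℕ) (x : Pref S t) (y : S (t + 1)) : ℝ :=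
  m.V s₀ (t + 1) (x, y)

/-- `E_{s_{t+1} ∼ π_ref(· | s_0, s_{1:t})} V(s_0, s_{1:t+1})`. -/
def expNext (m : Model S) (s₀ : S 0) (t : ℕ) (x : Pref S t) : ℝ :=
  ∑' y, (m.ref s₀ t x y).toReal * m.nextV s₀ t x y

/-- The reward model is positive up to the horizon, and one step changes it by at most a
factor `L`. -/
def RatioBound (m : Model S) (s₀ : S 0) (T : ℕ) (L : ℝ) : Prop :=
  (∀ t ≤ T, ∀ x, 0 < m.V s₀ t x) ∧
  ∀ t < T, ∀ (x : Pref S t) (y : S (t + 1)),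
    max (m.V s₀ t x / m.nextV s₀ t x y) (m.nextV s₀ t x y / m.V s₀ t x) ≤ L

/-- The one-step Bellman error is at most `ε`, at every prefix that has a next step. -/
def BellmanBound (m : Model S) (s₀ : S 0) (T : ℕ) (ε : ℝ) : Prop :=
  ∀ t < T, ∀ x : Pref S t,
    max (m.V s₀ t x / m.expNext s₀ t x) (m.expNext s₀ t x / m.V s₀ t x) ≤ 1 + ε

end Model

/-! ### Sequential Monte Carlo with the optimal proposal

One round = propagate every particle by rejection sampling, estimate the incremental weights by
Monte Carlo, resample. The resampling that opens step `t + 1` of the usual presentation closes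
round `t` here, so that the last round contains the terminal resampling and the `N` particles
before the first round are all the empty prefix. -/

/-- Everything drawn in one round: the rejection-sampling runs, the Monte-Carlo samples, and the
ancestor indices. -/
structure Round (α : Type v) (N Nm n : ℕ) : Type v where
  rs : Fin N → RSRun α n
  mc : Fin N → Fin Nm → α
  anc : Fin N → Fin N

/-- Cost of a round: the rejection-sampling runs; per particle `Nm` base draws, `Nm` reward
evaluations, one reward evaluation at the old prefix and one weight; one ancestor draw per
particle. -/
def Round.time {α : Type v} {N Nm n : ℕ} (r : Round α N Nm n) : ℕ :=
  (∑ i, (r.rs i).time) + N * (2 * Nm + 2) + N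

/-- Everything drawn in the first `t` rounds. -/
def Hist (S : ℕ → Type u) (N Nm n : ℕ) : ℕ → Type u
  | 0 => PUnit
  | t + 1 => Hist S N Nm n t × Round (S (t + 1)) N Nm n

/-- The particles after `t` rounds (after resampling). -/
def particles {S : ℕ → Type u} {N Nm n : ℕ} :
    (t : ℕ) → Hist S N Nm n t → Fin N → Pref S t
  | 0, _ => fun _ => PUnit.unit
  | t + 1, (h, r) => fun i => (particles t h (r.anc i), (r.rs (r.anc i)).out)

/-- The cost of the first `t` rounds. -/
def histTime {S : ℕ → Type u} {N Nm n : ℕ} : (t : ℕ) → Hist S N Nm n t → ℕ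
  | 0, _ => 0
  | t + 1, (h, r) => histTime t h + r.time

namespace Model
variable {S : ℕ → Type u}

/-- The law of a round that starts from the particles `x`. The weight of particle `j` is the
Monte-Carlo estimate of `E V(s_0, (x_j, ·))` divided by `V(s_0, x_j)`. -/
def roundLaw (m : Model S) (s₀ : S 0) (t N Nm n : ℕ) [NeZero N] (M : ℝ)
    (x : Fin N → Pref S t) : PMF (Round (S (t + 1)) N Nm n) :=
  (indep N fun i => rejectionSampling (m.nextV s₀ t (x i)) (m.ref s₀ t (x i)) M n).bind fun rs =>
    (indep N fun j => indep Nm fun _ => m.ref s₀ t (x j)).bind fun mc =>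
      (indep N fun _ => categorical fun j =>
        ((∑ k, m.nextV s₀ t (x j) (mc j k)) / Nm) / m.V s₀ t (x j)).map fun anc =>
          ⟨rs, mc, anc⟩

/-- The law of the first `t` rounds. -/
def histLaw (m : Model S) (s₀ : S 0) (N Nm n : ℕ) [NeZero N] (M : ℝ) :
    (t : ℕ) → PMF (Hist S N Nm n t)
  | 0 => PMF.pure PUnit.unit
  | t + 1 => (histLaw m s₀ N Nm n M t).bind fun h =>
      (m.roundLaw s₀ t N Nm n M (particles t h)).map fun r => (h, r)

end Model

/-- A complete run: all draws of the `T` rounds and the uniform index of the output particle. -/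
abbrev Run (S : ℕ → Type u) (T N Nm n : ℕ) : Type u := Hist S N Nm n T × Fin N

/-- The law of a complete run of the sampler with `N` particles, `Nm` Monte-Carlo samples per
weight, and rejection sampling with threshold `M` and failure probability `δ'`. -/
def Model.smc {S : ℕ → Type u} (m : Model S) (s₀ : S 0) (T N Nm : ℕ) [NeZero N] (M δ' : ℝ) :
    PMF (Run S T N Nm (rsBudget M δ')) :=
  (m.histLaw s₀ N Nm (rsBudget M δ') M T).bind fun h =>
    (PMF.uniformOfFintype (Fin N)).map fun i => (h, i)

/-- The output trajectory of a run. -/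
def Run.out {S : ℕ → Type u} {T N Nm n : ℕ} (ω : Run S T N Nm n) : Pref S T :=
  particles T ω.1 ω.2

/-- The running time of a run: the cost of its rounds and of the output index. -/
def Run.time {S : ℕ → Type u} {T N Nm n : ℕ} (ω : Run S T N Nm n) : ℕ :=
  histTime T ω.1 + 1

end OptSMC

end

/-! The sampler is compared with an idealized one whose proposals are exact draws from the tilted
law `π_ref · V`. Rejection sampling with threshold `4 L (1 + c₁)` dominates `1 - δ'` times that law
(`tilt_le_rejectionSampling`). Over all `N T` calls, the true law of the particles therefore
dominates `(1 - δ') ^ (N T)` times the idealized one, and failures cost at most `δ' N T = δ / K` in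
total variation.

In the idealized system the particles carry an accumulated weight `W`, a product of one factor per
round that makes each round unbiased for the backward operator `pull`. The target is then the mean
of `(W / Z) ×` the empirical measure, with `Z = E W`, while the output law is the same mean without
`W / Z`. Both dominate the mean of `min (W / Z) 1 ×` the empirical measure, so their distance is at
most `1 - E min (W / Z) 1` (`tvDist_target_smc_le`). It remains to show that `W / Z` is close to
`1`, in two regimes.

If `ε T ≤ δTV / 4`, one particle suffices. Resampling is then vacuous and the factors can be taken
to be the exact weights, which lie within `1 + ε` of `1`; hence `W / Z ≥ (1 + ε) ^ (-2T) ≥ 1 - 2 ε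
T`.

Otherwise `N` is of order `T / δTV ^ 2`, and `W` is the product of the mean Monte-Carlo weights.
Multiplied by the particle mean of the lookahead function `E[V(s_{1:T}) | s_{1:t}] / V(s_{1:t})`, it
becomes a martingale. The lookahead stays within `(1 + c₁ / T) ^ T ≤ exp c₁` of `1`, and `⌈L⌉`
samples per weight keep variances bounded, so one round multiplies the second moment by at most `1 +
O(1 / N)` (`expect_meanWeight_sq_le`). Thus `W / Z` has variance `O(T / N)`, which
`one_le_expect_min_add` turns into overlap.

A run costs `N T L` up to logarithms. In the second regime `1 < 4 ε T / δTV`, so `N T = O(T ^ 2 /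
δTV ^ 2)` is absorbed by `ε T ^ 5 / δTV ^ 3`. -/

namespace OptSMC

/-! ### Expectations of nonnegative functions -/

section Expect
variable {α β : Type*}

/-- The expectation of a nonnegative function under a discrete law. -/
noncomputable def expect (p : PMF α) (f : α → ℝ≥0∞) : ℝ≥0∞ := ∑' a, p a * f a

theorem expect_pure (a : α) (f : α → ℝ≥0∞) : expect (PMF.pure a) f = f a := by
  rw [expect, tsum_eq_single a]
  · simp
  · intro b hb; simp [hb]

theorem expect_bind (p : PMF α) (k : α → PMF β) (f : β → ℝ≥0∞) :
    expect (p.bind k) f = expect p fun a => expect (k a) f := by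
  simp only [expect, PMF.bind_apply, ← ENNReal.tsum_mul_right, ← ENNReal.tsum_mul_left]
  rw [ENNReal.tsum_comm]
  simp only [mul_assoc]

theorem expect_map (p : PMF α) (k : α → β) (f : β → ℝ≥0∞) :
    expect (p.map k) f = expect p fun a => f (k a) := by
  rw [← PMF.bind_pure_comp, expect_bind]
  simp only [Function.comp, expect_pure]

theorem expect_const (p : PMF α) (c : ℝ≥0∞) : expect p (fun _ => c) = c := by
  rw [expect, ENNReal.tsum_mul_right, p.tsum_coe, one_mul]

theorem expect_add (p : PMF α) (f g : α → ℝ≥0∞) :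
    expect p (fun a => f a + g a) = expect p f + expect p g := by
  simp only [expect, mul_add, ENNReal.tsum_add]

theorem expect_mul_left (p : PMF α) (c : ℝ≥0∞) (f : α → ℝ≥0∞) :
    expect p (fun a => c * f a) = c * expect p f := by
  simp only [expect, ← ENNReal.tsum_mul_left, mul_left_comm]

theorem expect_mul_right (p : PMF α) (c : ℝ≥0∞) (f : α → ℝ≥0∞) :
    expect p (fun a => f a * c) = expect p f * c := by
  simp only [expect, ← ENNReal.tsum_mul_right, mul_assoc]

theorem expect_mono (p : PMF α) {f g : α → ℝ≥0∞} (h : ∀ a, f a ≤ g a) :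
    expect p f ≤ expect p g :=
  ENNReal.tsum_le_tsum fun a => by gcongr; exact h a

theorem expect_le (p : PMF α) {f : α → ℝ≥0∞} {c : ℝ≥0∞} (h : ∀ a, f a ≤ c) : expect p f ≤ c :=
  (expect_mono p h).trans_eq (expect_const p c)

theorem le_expect (p : PMF α) {f : α → ℝ≥0∞} {c : ℝ≥0∞} (h : ∀ a, c ≤ f a) : c ≤ expect p f :=
  (expect_const p c).symm.trans_le (expect_mono p h)

theorem expect_tsum {ι : Type*} (p : PMF α) (f : ι → α → ℝ≥0∞) :
    expect p (fun a => ∑' i, f i a) = ∑' i, expect p (f i) := by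
  simp only [expect, ← ENNReal.tsum_mul_left]
  exact ENNReal.tsum_comm

theorem apply_eq_expect [DecidableEq α] (p : PMF α) (a : α) :
    p a = expect p fun b => if b = a then 1 else 0 := by
  rw [expect, tsum_eq_single a]
  · simp
  · intro b hb; simp [hb]

theorem expect_le_of_dominated {p q : PMF α} {θ : ℝ≥0∞} (h : ∀ a, θ * q a ≤ p a)
    (f : α → ℝ≥0∞) : θ * expect q f ≤ expect p f := by
  rw [expect, ← ENNReal.tsum_mul_left]
  refine ENNReal.tsum_le_tsum fun a => ?_
  rw [← mul_assoc]
  gcongr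
  exact h a

end Expect

/-! ### Independent vectors -/

section Indep
variable {α : Type v} {β : Type*}

theorem expect_indep_succ {n : ℕ} (p : Fin (n + 1) → PMF α) (f : (Fin (n + 1) → α) → ℝ≥0∞) :
    expect (indep (n + 1) p) f =
      expect (p 0) fun x => expect (indep n fun i => p i.succ) fun xs => f (Fin.cons x xs) := by
  simp only [indep, expect_bind, expect_map]

theorem expect_indep_prod {n : ℕ} (p : Fin n → PMF α) (f : Fin n → α → ℝ≥0∞) :
    expect (indep n p) (fun x => ∏ i, f i (x i)) = ∏ i, expect (p i) (f i) := by
  induction n with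
  | zero => simp [indep, expect_pure]
  | succ n ih =>
    simp only [expect_indep_succ, Fin.prod_univ_succ, Fin.cons_zero, Fin.cons_succ,
      expect_mul_left, expect_mul_right, ih (fun i => p i.succ) fun i => f i.succ]

theorem expect_indep_sum {n : ℕ} (p : Fin n → PMF α) (f : Fin n → α → ℝ≥0∞) :
    expect (indep n p) (fun x => ∑ i, f i (x i)) = ∑ i, expect (p i) (f i) := by
  induction n with
  | zero => simp [indep, expect_pure]
  | succ n ih =>
    simp only [expect_indep_succ, Fin.sum_univ_succ, Fin.cons_zero, Fin.cons_succ,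
      expect_add, expect_const, ih (fun i => p i.succ) fun i => f i.succ]

/-- The second moment of a sum of independent nonnegative variables. -/
theorem expect_indep_sum_sq_le {n : ℕ} (p : Fin n → PMF α) (f : Fin n → α → ℝ≥0∞) :
    expect (indep n p) (fun x => (∑ i, f i (x i)) ^ 2) ≤
      ∑ i, expect (p i) (fun a => f i a ^ 2) + (∑ i, expect (p i) (f i)) ^ 2 := by
  induction n with
  | zero => simp [indep, expect_pure]
  | succ n ih =>
    have ih' := ih (fun i => p i.succ) fun i => f i.succ
    have key : ∀ a b : ℝ≥0∞, (a + b) ^ 2 = a ^ 2 + 2 * a * b + b ^ 2 := fun a b => by ring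
    simp only [expect_indep_succ, Fin.sum_univ_succ, Fin.cons_zero, Fin.cons_succ, key,
      expect_add, expect_const, expect_mul_left, expect_mul_right,
      expect_indep_sum (fun i => p i.succ) fun i => f i.succ]
    calc _ ≤ expect (p 0) (fun a => f 0 a ^ 2)
          + 2 * expect (p 0) (f 0) * ∑ i : Fin n, expect (p i.succ) (f i.succ)
          + (∑ i : Fin n, expect (p i.succ) (fun a => f i.succ a ^ 2)
            + (∑ i : Fin n, expect (p i.succ) (f i.succ)) ^ 2) := by gcongr
      _ ≤ expect (p 0) (fun a => f 0 a ^ 2)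
          + 2 * expect (p 0) (f 0) * ∑ i : Fin n, expect (p i.succ) (f i.succ)
          + (∑ i : Fin n, expect (p i.succ) (fun a => f i.succ a ^ 2)
            + (∑ i : Fin n, expect (p i.succ) (f i.succ)) ^ 2) + expect (p 0) (f 0) ^ 2 :=
          le_self_add
      _ = _ := by ring

/-- Domination tensorizes: coordinates are replaced one at a time, each at the cost of a factor `θ`.
The map `k` lets a rejection-sampling run stand for its returned sample. -/
theorem expect_indep_le_of_dominated {n : ℕ} {p : Fin n → PMF β} {q : Fin n → PMF α}
    {k : β → α} {θ : ℝ≥0∞}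
    (h : ∀ i (f : α → ℝ≥0∞), θ * expect (q i) f ≤ expect (p i) fun b => f (k b))
    (f : (Fin n → α) → ℝ≥0∞) :
    θ ^ n * expect (indep n q) f ≤ expect (indep n p) fun x => f fun i => k (x i) := by
  induction n with
  | zero =>
    simp only [indep, expect_pure, pow_zero, one_mul]
    exact le_of_eq (congrArg f (Subsingleton.elim _ _))
  | succ n ih =>
    rw [expect_indep_succ, expect_indep_succ, pow_succ, mul_assoc]
    refine (mul_le_mul_right (h 0 _) _).trans ?_
    rw [← expect_mul_left]
    refine expect_mono _ fun b => ?_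
    refine (ih (fun i => h i.succ) _).trans (expect_mono _ fun xs => le_of_eq (congrArg f ?_))
    funext i
    refine Fin.cases ?_ (fun j => ?_) i <;> simp

end Indep

/-! ### Tilted laws and total variation -/

theorem normalizeOr_apply {α : Type v} (μ : PMF α) (w : α → ℝ≥0∞) (h0 : ∑' a, w a ≠ 0)
    (h1 : ∑' a, w a ≠ ∞) (a : α) : normalizeOr μ w a = w a / ∑' b, w b := by
  rw [normalizeOr, dif_pos ⟨h0, h1⟩, PMF.normalize_apply, div_eq_mul_inv]

theorem tilt_apply {α : Type v} (μ : PMF α) (g : α → ℝ)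
    (h0 : expect μ (fun a => ENNReal.ofReal (g a)) ≠ 0)
    (h1 : expect μ (fun a => ENNReal.ofReal (g a)) ≠ ∞) (a : α) :
    tilt μ g a = μ a * ENNReal.ofReal (g a) / expect μ (fun a => ENNReal.ofReal (g a)) :=
  normalizeOr_apply μ _ h0 h1 a

/-- Two laws with a common minorant of mass at least `1 - d` are at distance at most `d`. -/
theorem tvDist_le_of_minorant {α : Type v} {μ ν : PMF α} {m : α → ℝ≥0∞} {d : ℝ} (hd : 0 ≤ d)
    (hμ : ∀ a, m a ≤ μ a) (hν : ∀ a, m a ≤ ν a) (hm : 1 ≤ ∑' a, m a + ENNReal.ofReal d) :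
    tvDist μ ν ≤ d := by
  have sμ : Summable fun a => (μ a).toReal := ENNReal.summable_toReal μ.tsum_coe_ne_top
  have sν : Summable fun a => (ν a).toReal := ENNReal.summable_toReal ν.tsum_coe_ne_top
  have hmtop : ∑' a, m a ≠ ∞ :=
    ne_top_of_le_ne_top μ.tsum_coe_ne_top (ENNReal.tsum_le_tsum hμ)
  have sm : Summable fun a => (m a).toReal := ENNReal.summable_toReal hmtop
  have tμ : ∑' a, (μ a).toReal = 1 := by
    rw [← ENNReal.tsum_toReal_eq μ.apply_ne_top, μ.tsum_coe, ENNReal.toReal_one]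
  have tν : ∑' a, (ν a).toReal = 1 := by
    rw [← ENNReal.tsum_toReal_eq ν.apply_ne_top, ν.tsum_coe, ENNReal.toReal_one]
  have tm : ∑' a, (m a).toReal = (∑' a, m a).toReal :=
    (ENNReal.tsum_toReal_eq (ENNReal.ne_top_of_tsum_ne_top hmtop)).symm
  have hm' : 1 ≤ (∑' a, m a).toReal + d := by
    have := ENNReal.toReal_mono (by simp [hmtop]) hm
    rwa [ENNReal.toReal_add hmtop ENNReal.ofReal_ne_top, ENNReal.toReal_ofReal hd,
      ENNReal.toReal_one] at this
  have hs : Summable fun a => (μ a).toReal + (ν a).toReal - 2 * (m a).toReal :=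
    (sμ.add sν).sub (sm.mul_left 2)
  have hle : ∀ a, |(μ a).toReal - (ν a).toReal| ≤
      (μ a).toReal + (ν a).toReal - 2 * (m a).toReal := fun a => by
    have h1 := ENNReal.toReal_mono (μ.apply_ne_top a) (hμ a)
    have h2 := ENNReal.toReal_mono (ν.apply_ne_top a) (hν a)
    rw [abs_le]; constructor <;> linarith
  have hsum : ∑' a, |(μ a).toReal - (ν a).toReal| ≤ 2 * d := by
    refine ((Summable.of_nonneg_of_le (fun _ => abs_nonneg _) hle hs).tsum_le_tsum hle hs).trans ?_
    rw [(sμ.add sν).tsum_sub (sm.mul_left 2), sμ.tsum_add sν, tsum_mul_left, tμ, tν, tm]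
    linarith
  rw [tvDist]; linarith

/-! ### Rejection sampling -/

section Rejection
variable {α : Type v}

/-- This is the recursion behind the induction on the number of trials. `zs'` is arbitrary because
the output ignores the draws used for the normalizer. -/
theorem RSRun.out_cons {n : ℕ} (zs : Fin (n + 1) → α) (zs' : Fin n → α) (p : α × Bool)
    (tr : Fin n → α × Bool) (z : α) :
    (⟨zs, Fin.cons p tr, z⟩ : RSRun α (n + 1)).out =
      if p.2 then p.1 else (⟨zs', tr, z⟩ : RSRun α n).out := by
  rcases p with ⟨a, b⟩
  simp only [RSRun.out, RSRun.firstAccept, List.finRange_succ, List.find?_cons, Fin.cons_zero,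
    List.find?_map]
  cases b
  · simp only [Bool.false_eq_true, if_false]
    have : ((fun i : Fin (n + 1) => (Fin.cons (a, false) tr : Fin (n + 1) → α × Bool) i |>.2) ∘
        Fin.succ) = fun i => (tr i).2 := by
      funext i; simp
    rw [this]
    cases List.find? (fun i => (tr i).2) (List.finRange n) <;> simp
  · simp

theorem RSRun.time_le {n : ℕ} (r : RSRun α n) : r.time ≤ 5 * n + 1 := by
  unfold RSRun.time
  cases r.firstAccept with
  | none => simp only; omega
  | some i => have := i.2; simp only; omega

theorem expect_coin {r : ℝ} (h0 : 0 ≤ r) (h1 : r ≤ 1) (f : Bool → ℝ≥0∞) :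
    expect (coin r) f = ENNReal.ofReal r * f true + ENNReal.ofReal (1 - r) * f false := by
  have hr : min r.toNNReal 1 = r.toNNReal := min_eq_left (Real.toNNReal_le_one.2 h1)
  have ht : coin r true = ENNReal.ofReal r := by
    simp only [coin, hr]; rfl
  have hs : coin r true + coin r false = 1 := by
    rw [← (coin r).tsum_coe, tsum_bool, add_comm]
  rw [expect, tsum_bool, add_comm, ht]
  congr 2
  rw [ht] at hs
  rw [ENNReal.ofReal_sub _ h0, ENNReal.ofReal_one, ← hs]
  exact (ENNReal.add_sub_cancel_left ENNReal.ofReal_ne_top).symm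

/-- The first accepted trial has law `Q` up to the probability `b ^ n` that nothing is accepted. -/
theorem le_expect_firstAccept (ν : PMF (α × Bool)) (F : α → ℝ≥0∞) {a b Q : ℝ≥0∞} (hab : a + b = 1)
    (hν : ∀ X, expect ν (fun p => if p.2 then F p.1 else X) = a * Q + b * X)
    {n : ℕ} (zs : Fin n → α) (z : α) :
    Q ≤ expect (indep n fun _ => ν) (fun tr => F (RSRun.out ⟨zs, tr, z⟩)) + b ^ n * Q := by
  induction n with
  | zero => simp
  | succ n ih =>
    have ih' := ih fun i => zs i.succ
    have hstep : expect (indep (n + 1) fun _ => ν) (fun tr => F (RSRun.out ⟨zs, tr, z⟩)) =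
        a * Q + b * expect (indep n fun _ => ν)
          (fun tr => F (RSRun.out ⟨fun i => zs i.succ, tr, z⟩)) := by
      rw [expect_indep_succ, ← hν]
      congr 1
      funext p
      simp only [RSRun.out_cons zs fun i => zs i.succ]
      by_cases hp : p.2 <;> simp [hp, expect_const]
    rw [hstep]
    calc Q = a * Q + b * Q := by rw [← add_mul, hab, one_mul]
      _ ≤ a * Q + b * (expect (indep n fun _ => ν)
          (fun tr => F (RSRun.out ⟨fun i => zs i.succ, tr, z⟩)) + b ^ n * Q) := by gcongr
      _ = _ := by ring

/-- Since `c * g ≤ 1`, the acceptance probability is never clipped. A trial thus accepts with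
probability exactly `c Z`, and the accepted value has exactly the tilted law. -/
theorem expect_trial (μ : PMF α) {g : α → ℝ} {Z c : ℝ} (hg : ∀ a, 0 ≤ g a)
    (hZ : expect μ (fun a => ENNReal.ofReal (g a)) = ENNReal.ofReal Z) (hZ0 : 0 < Z)
    (hc : 0 ≤ c) (hcg : ∀ a, c * g a ≤ 1) (F : α → ℝ≥0∞) (X : ℝ≥0∞) :
    expect (μ.bind fun z => (coin (c * g z)).map fun b => (z, b))
        (fun p => if p.2 then F p.1 else X) =
      ENNReal.ofReal (c * Z) * expect (tilt μ g) F + ENNReal.ofReal (1 - c * Z) * X := by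
  have hg' : ∀ a, 0 ≤ c * g a := fun a => mul_nonneg hc (hg a)
  have h1 : expect μ (fun a => ENNReal.ofReal (c * g a)) = ENNReal.ofReal (c * Z) := by
    simp only [ENNReal.ofReal_mul hc, expect_mul_left, hZ]
  have h2 : expect μ (fun a => ENNReal.ofReal (1 - c * g a)) = ENNReal.ofReal (1 - c * Z) := by
    have h3 : expect μ (fun a => ENNReal.ofReal (1 - c * g a)) + ENNReal.ofReal (c * Z) = 1 := by
      rw [← h1, ← expect_add, ← expect_const μ 1]
      congr 1
      funext a
      rw [← ENNReal.ofReal_add (sub_nonneg.2 (hcg a)) (hg' a)]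
      simp
    rw [ENNReal.ofReal_sub _ (mul_nonneg hc hZ0.le), ENNReal.ofReal_one, ← h3]
    exact (ENNReal.add_sub_cancel_right ENNReal.ofReal_ne_top).symm
  have h4 : expect (tilt μ g) F * ENNReal.ofReal Z =
      expect μ fun a => ENNReal.ofReal (g a) * F a := by
    have hne : ENNReal.ofReal Z ≠ 0 := by simpa using hZ0
    simp only [expect, ← ENNReal.tsum_mul_right]
    refine tsum_congr fun a => ?_
    rw [tilt_apply μ g (by rwa [hZ]) (by simp [hZ]), hZ, mul_right_comm,
      ENNReal.div_mul_cancel hne ENNReal.ofReal_ne_top, mul_assoc]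
  simp only [expect_bind, expect_map, expect_coin (hg' _) (hcg _), Bool.false_eq_true, if_true,
    if_false, expect_add, expect_mul_right, h2, ENNReal.ofReal_mul hc, mul_assoc, expect_mul_left]
  rw [← h4, mul_comm (expect _ F)]

/-- The Chernoff step: the moment generating function of a sum factorizes over independent draws. -/
theorem expect_indep_exp_le (μ : PMF α) (f : α → ℝ) {s : ℝ} (n : ℕ) (u : ℝ)
    (h : expect μ (fun a => ENNReal.ofReal (Real.exp (f a))) ≤ ENNReal.ofReal (Real.exp s)) :
    expect (indep n fun _ => μ) (fun x => ENNReal.ofReal (Real.exp (∑ i, f (x i) - u))) ≤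
      ENNReal.ofReal (Real.exp (n * s - u)) := by
  have : ∀ x : Fin n → α, ENNReal.ofReal (Real.exp (∑ i, f (x i) - u)) =
      (∏ i, ENNReal.ofReal (Real.exp (f (x i)))) * ENNReal.ofReal (Real.exp (-u)) := fun x => by
    rw [← ENNReal.ofReal_prod_of_nonneg fun i _ => (Real.exp_pos _).le, ← Real.exp_sum,
      ← ENNReal.ofReal_mul (Real.exp_pos _).le, ← Real.exp_add, sub_eq_add_neg]
  simp only [this, expect_mul_right, expect_indep_prod (fun _ => μ)
    fun _ a => ENNReal.ofReal (Real.exp (f a)), Finset.prod_const, Finset.card_univ,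
    Fintype.card_fin]
  calc _ ≤ ENNReal.ofReal (Real.exp s) ^ n * ENNReal.ofReal (Real.exp (-u)) := by gcongr
    _ = _ := by
      rw [← ENNReal.ofReal_pow (Real.exp_pos _).le, ← Real.exp_nat_mul,
        ← ENNReal.ofReal_mul (by positivity), ← Real.exp_add, sub_eq_add_neg]

/-- Multiplicative Chernoff bound: the mean of `n` scores is within a factor `4` of its
expectation, up to exponentially small probability. -/
theorem expect_normalizer_bad_le (μ : PMF α) {g : α → ℝ} {Z B : ℝ} (hg : ∀ a, 0 ≤ g a)
    (hZ : expect μ (fun a => ENNReal.ofReal (g a)) = ENNReal.ofReal Z) (hZ0 : 0 < Z)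
    (hB : 0 < B) (hgB : ∀ a, g a ≤ B * Z) {n : ℕ} (hn : 0 < n) :
    expect (indep n fun _ => μ) (fun zs => open Classical in
      if Z / 4 ≤ (∑ i, g (zs i)) / n ∧ (∑ i, g (zs i)) / n ≤ 4 * Z then 0 else 1) ≤
      2 * ENNReal.ofReal (Real.exp (-(n / (4 * B)))) := by
  have hn' : (0 : ℝ) < n := by exact_mod_cast hn
  have hBZ : 0 < B * Z := mul_pos hB hZ0
  set X : α → ℝ := fun a => g a / (B * Z) with hX
  have hX0 : ∀ a, 0 ≤ X a := fun a => div_nonneg (hg a) hBZ.le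
  have hX1 : ∀ a, X a ≤ 1 := fun a => (div_le_one hBZ).2 (hgB a)
  have hEX : ∀ c : ℝ, 0 ≤ c →
      expect μ (fun a => ENNReal.ofReal (c * X a)) = ENNReal.ofReal (c / B) := fun c hc => by
    have : ∀ a, c * X a = c / (B * Z) * g a := fun a => by rw [hX]; ring
    have hc' : 0 ≤ c / (B * Z) := div_nonneg hc hBZ.le
    simp only [this, ENNReal.ofReal_mul hc', expect_mul_left, hZ]
    rw [← ENNReal.ofReal_mul hc']
    congr 1
    field_simp
  -- `X` has values in `[0, 1]` and mean `1 / B`. The upper tail uses `exp x ≤ 1 + 2 x` on `[0, 1]`,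
  -- the lower tail `exp (-x) ≤ 1 - x / 2`.
  have hup : expect μ (fun a => ENNReal.ofReal (Real.exp (X a))) ≤
      ENNReal.ofReal (Real.exp (2 / B)) := by
    have : ∀ a, ENNReal.ofReal (Real.exp (X a)) ≤ 1 + ENNReal.ofReal (2 * X a) := fun a => by
      rw [← ENNReal.ofReal_one, ← ENNReal.ofReal_add zero_le_one (by linarith [hX0 a])]
      refine ENNReal.ofReal_le_ofReal ?_
      have := Real.abs_exp_sub_one_sub_id_le (x := X a) (by rw [abs_of_nonneg (hX0 a)]; exact hX1 a)
      nlinarith [hX0 a, hX1 a, abs_le.1 this]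
    refine (expect_mono μ this).trans ?_
    rw [expect_add, expect_const, hEX 2 zero_le_two, ← ENNReal.ofReal_one,
      ← ENNReal.ofReal_add zero_le_one (by positivity)]
    exact ENNReal.ofReal_le_ofReal (by linarith [Real.add_one_le_exp (2 / B)])
  have hlow : expect μ (fun a => ENNReal.ofReal (Real.exp (-X a))) ≤
      ENNReal.ofReal (Real.exp (-(1 / 2 / B))) := by
    have : ∀ a, ENNReal.ofReal (Real.exp (-X a)) + ENNReal.ofReal (1 / 2 * X a) ≤ 1 := fun a => by
      rw [← ENNReal.ofReal_one, ← ENNReal.ofReal_add (Real.exp_pos _).le (by linarith [hX0 a])]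
      refine ENNReal.ofReal_le_ofReal ?_
      have h1 : Real.exp (-X a) * Real.exp (X a) = 1 := by rw [← Real.exp_add]; simp
      nlinarith [Real.exp_pos (-X a), Real.add_one_le_exp (X a), hX0 a, hX1 a]
    have h := expect_le μ this
    rw [expect_add, hEX (1 / 2) (by norm_num)] at h
    have hlt : expect μ (fun a => ENNReal.ofReal (Real.exp (-X a))) ≤
        1 - ENNReal.ofReal (1 / 2 / B) :=
      ENNReal.le_sub_of_add_le_right ENNReal.ofReal_ne_top h
    refine hlt.trans ?_
    rw [← ENNReal.ofReal_one, ← ENNReal.ofReal_sub _ (by positivity)]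
    exact ENNReal.ofReal_le_ofReal (by linarith [Real.add_one_le_exp (-(1 / 2 / B))])
  -- Markov's inequality in pointwise form: when the mean leaves `[Z / 4, 4 Z]`, one of the two
  -- exponentials is at least `1`.
  have hpt : ∀ zs : Fin n → α, (open Classical in
      if Z / 4 ≤ (∑ i, g (zs i)) / n ∧ (∑ i, g (zs i)) / n ≤ 4 * Z then (0 : ℝ≥0∞) else 1) ≤
      ENNReal.ofReal (Real.exp (∑ i, X (zs i) - 4 * n / B)) +
        ENNReal.ofReal (Real.exp (∑ i, -X (zs i) - (-(n / (4 * B))))) := fun zs => by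
    have hsum : ∑ i, X (zs i) = (∑ i, g (zs i)) / (B * Z) := by rw [Finset.sum_div]
    split_ifs with h
    · exact bot_le
    · rcases not_and_or.1 h with h | h
      · refine le_trans ?_ le_add_self
        rw [← ENNReal.ofReal_one]
        refine ENNReal.ofReal_le_ofReal (Real.one_le_exp ?_)
        rw [Finset.sum_neg_distrib, hsum]
        have : (∑ i, g (zs i)) / (B * Z) ≤ n / (4 * B) := by
          rw [not_le, div_lt_iff₀ hn'] at h
          rw [div_le_div_iff₀ hBZ (by positivity)]
          nlinarith
        linarith
      · refine le_trans ?_ le_self_add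
        rw [← ENNReal.ofReal_one]
        refine ENNReal.ofReal_le_ofReal (Real.one_le_exp ?_)
        rw [hsum]
        have : 4 * n / B ≤ (∑ i, g (zs i)) / (B * Z) := by
          rw [not_le, lt_div_iff₀ hn'] at h
          rw [div_le_div_iff₀ hB hBZ]
          nlinarith
        linarith
  refine (expect_mono _ hpt).trans ?_
  rw [expect_add, two_mul]
  refine add_le_add ?_ ?_
  · refine (expect_indep_exp_le μ X n _ hup).trans (ENNReal.ofReal_le_ofReal ?_)
    rw [Real.exp_le_exp]
    have : n / (4 * B) ≤ 2 * (n / B) := by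
      rw [div_le_iff₀ (by positivity)]; field_simp; norm_num
    have e1 : n * (2 / B) - 4 * n / B = -(2 * (n / B)) := by ring
    linarith
  · refine (expect_indep_exp_le μ (fun a => -X a) n _ hlow).trans (ENNReal.ofReal_le_ofReal ?_)
    rw [Real.exp_le_exp]
    have : n * -(1 / 2 / B) - -(n / (4 * B)) = -(n / (4 * B)) := by field_simp; norm_num
    exact this.le

/-- Rejection sampling with threshold `4 B`, where the score is at most `B` times its mean,
dominates `1 - δ` times the tilted law. -/
theorem tilt_le_rejectionSampling (μ : PMF α) {g : α → ℝ} {Z B δ : ℝ} (hg : ∀ a, 0 ≤ g a)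
    (hZ : expect μ (fun a => ENNReal.ofReal (g a)) = ENNReal.ofReal Z) (hZ0 : 0 < Z)
    (hB : 0 < B) (hgB : ∀ a, g a ≤ B * Z) (hδ0 : 0 < δ) (hδ1 : δ ≤ 1) (f : α → ℝ≥0∞) :
    ENNReal.ofReal (1 - δ) * expect (tilt μ g) f ≤
      expect (rejectionSampling g μ (4 * B) (rsBudget (4 * B) δ)) fun r => f r.out := by
  classical
  set n := rsBudget (4 * B) δ with hn
  have hlog : 0 < Real.log (4 / δ) := Real.log_pos (by rw [lt_div_iff₀ hδ0]; linarith)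
  have hnle : 4 * (4 * B) * Real.log (4 / δ) ≤ n := Nat.le_ceil _
  have hn' : (0 : ℝ) < n := lt_of_lt_of_le (by positivity) hnle
  have hn0 : 0 < n := by exact_mod_cast hn'
  have hexp : Real.exp (-Real.log (4 / δ)) = δ / 4 := by
    rw [Real.exp_neg, Real.exp_log (by positivity), inv_div]
  -- Indicators suffice, because domination of the point masses extends to all nonnegative
  -- functions. The bound `f ≤ 1` keeps `Q` finite for the subtraction at the end.
  suffices hQ : ∀ f : α → ℝ≥0∞, (∀ a, f a ≤ 1) → ENNReal.ofReal (1 - δ) * expect (tilt μ g) f ≤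
      expect (rejectionSampling g μ (4 * B) n) fun r => f r.out by
    have := expect_le_of_dominated (p := (rejectionSampling g μ (4 * B) n).map RSRun.out)
      (q := tilt μ g) (θ := ENNReal.ofReal (1 - δ)) (fun a => ?_) f
    · rwa [expect_map] at this
    · rw [apply_eq_expect, apply_eq_expect (PMF.map _ _), expect_map]
      exact hQ _ fun b => by split_ifs <;> simp
  intro f hf
  set Q := expect (tilt μ g) f with hQdef
  have hQ1 : Q ≤ 1 := expect_le _ hf
  -- The deficit is split into the chance that no trial accepts under a good normalizer, at most `δ
  -- / 4`, and the event of a bad normalizer, of probability at most `2 · δ / 4`.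
  have hgood : ∀ zs : Fin n → α, Q ≤
      expect (indep n fun _ => μ.bind fun z =>
        (coin (g z / (4 * B * ((∑ i, g (zs i)) / n)))).map fun b => (z, b))
        (fun tr => expect μ fun z => f (RSRun.out ⟨zs, tr, z⟩)) + ENNReal.ofReal (δ / 4) * Q +
      (if Z / 4 ≤ (∑ i, g (zs i)) / n ∧ (∑ i, g (zs i)) / n ≤ 4 * Z then 0 else 1) * Q := by
    intro zs
    split_ifs with h
    · set W := (∑ i, g (zs i)) / (n : ℝ) with hW
      have hW0 : 0 < W := lt_of_lt_of_le (by positivity) h.1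
      set c := 1 / (4 * B * W) with hc
      have hc0 : 0 < c := by positivity
      -- The lower bound `Z / 4 ≤ W` gives `4 B W ≥ B Z ≥ g`.
      have hcg : ∀ a, c * g a ≤ 1 := fun a => by
        rw [hc, one_div_mul_eq_div, div_le_one (by positivity)]
        nlinarith [hgB a, mul_le_mul_of_nonneg_left h.1 hB.le]
      have hcZ : c * Z ≤ 1 := by
        rw [← ENNReal.ofReal_le_one, ENNReal.ofReal_mul hc0.le, ← hZ, ← expect_mul_left]
        refine expect_le _ fun a => ?_
        rw [← ENNReal.ofReal_mul hc0.le]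
        exact ENNReal.ofReal_le_one.2 (hcg a)
      have hab : ENNReal.ofReal (c * Z) + ENNReal.ofReal (1 - c * Z) = 1 := by
        rw [← ENNReal.ofReal_add (by positivity) (by linarith)]; simp
      -- The upper bound `W ≤ 4 Z` gives acceptance probability at least `1 / (16 B)`, and there are
      -- at least `16 B log (4 / δ)` trials.
      have hfail : ENNReal.ofReal (1 - c * Z) ^ n ≤ ENNReal.ofReal (δ / 4) := by
        rw [← ENNReal.ofReal_pow (by linarith), ← hexp]
        refine ENNReal.ofReal_le_ofReal ?_
        calc (1 - c * Z) ^ n ≤ Real.exp (-(c * Z)) ^ n := by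
              gcongr
              exact Real.one_sub_le_exp_neg _
          _ = Real.exp (n * -(c * Z)) := (Real.exp_nat_mul _ _).symm
          _ ≤ Real.exp (-Real.log (4 / δ)) := by
            rw [Real.exp_le_exp]
            have : Real.log (4 / δ) ≤ n * (c * Z) := by
              have h1 : Z / (4 * B * (4 * Z)) ≤ c * Z := by
                rw [hc, one_div_mul_eq_div]
                gcongr
                exact h.2
              have h2 : Z / (4 * B * (4 * Z)) = 1 / (16 * B) := by field_simp; norm_num
              calc Real.log (4 / δ) = 4 * (4 * B) * Real.log (4 / δ) * (1 / (16 * B)) := by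
                    field_simp; norm_num
                _ ≤ n * (c * Z) := by rw [← h2]; gcongr
            linarith
      have hdiv : ∀ z, g z / (4 * B * W) = c * g z := fun z => by rw [hc]; ring
      simp only [hdiv, zero_mul, add_zero]
      have hz : ∀ z : α, Q ≤ expect (indep n fun _ => μ.bind fun z =>
          (coin (c * g z)).map fun b => (z, b)) (fun tr => f (RSRun.out ⟨zs, tr, z⟩)) +
          ENNReal.ofReal (δ / 4) * Q := fun z =>
        (le_expect_firstAccept _ f hab
          (expect_trial μ hg hZ hZ0 hc0.le hcg f) zs z).trans (by gcongr)
      have := le_expect μ hz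
      rw [expect_add, expect_const] at this
      convert this using 2
      simp only [expect, ← ENNReal.tsum_mul_left]
      rw [ENNReal.tsum_comm]
      simp only [mul_left_comm]
    · rw [one_mul]; exact le_add_self
  have hbad := expect_normalizer_bad_le μ hg hZ hZ0 hB hgB hn0
  have hbad' : ENNReal.ofReal (Real.exp (-(n / (4 * B)))) ≤ ENNReal.ofReal (δ / 4) := by
    rw [← hexp]
    refine ENNReal.ofReal_le_ofReal (Real.exp_le_exp.2 (neg_le_neg ?_))
    rw [le_div_iff₀ (by positivity)]
    nlinarith [mul_pos hB hlog]
  have hQE := le_expect (indep n fun _ => μ) hgood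
  rw [expect_add, expect_add, expect_const, expect_mul_right] at hQE
  have hsum : Q ≤ expect (rejectionSampling g μ (4 * B) n) (fun r => f r.out) +
      ENNReal.ofReal δ * Q := by
    refine hQE.trans ?_
    rw [add_assoc, ← add_mul]
    simp only [rejectionSampling, expect_bind, expect_map]
    gcongr
    refine (add_le_add_right (hbad.trans (mul_le_mul_right hbad' 2)) _).trans ?_
    rw [two_mul, ← ENNReal.ofReal_add (by positivity) (by positivity),
      ← ENNReal.ofReal_add (by positivity) (by positivity)]
    exact ENNReal.ofReal_le_ofReal (by linarith)
  rw [ENNReal.ofReal_sub _ hδ0.le, ENNReal.ofReal_one,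
    ENNReal.sub_mul fun _ _ => ne_top_of_le_ne_top ENNReal.one_ne_top hQ1, one_mul]
  exact tsub_le_iff_right.2 hsum

end Rejection
/-! ### Weights and the optimal proposal -/

section Avg
variable {α : Type*} {N : ℕ} [NeZero N]

/-- The mean of `f` over `N` particles. -/
noncomputable def avg (f : α → ℝ≥0∞) (x : Fin N → α) : ℝ≥0∞ := (∑ i, f (x i)) / N

theorem natCast_size_ne_zero : (N : ℝ≥0∞) ≠ 0 := Nat.cast_ne_zero.2 (NeZero.ne N)

theorem avg_const (c : ℝ≥0∞) (x : Fin N → α) : avg (fun _ => c) x = c := by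
  rw [avg, Finset.sum_const, Finset.card_univ, Fintype.card_fin, nsmul_eq_mul, mul_comm]
  exact ENNReal.mul_div_cancel_right natCast_size_ne_zero (ENNReal.natCast_ne_top N)

theorem expect_uniform (f : Fin N → ℝ≥0∞) :
    expect (PMF.uniformOfFintype (Fin N)) f = (∑ i, f i) / N := by
  simp only [expect, tsum_fintype, PMF.uniformOfFintype_apply, Fintype.card_fin,
    ENNReal.div_eq_inv_mul, Finset.mul_sum]

theorem tsum_avg_indicator [DecidableEq α] (x : Fin N → α) :
    ∑' a, avg (fun b => if b = a then 1 else 0) x = 1 := by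
  simp only [avg, ENNReal.div_eq_inv_mul, ENNReal.tsum_mul_left]
  have : ∑' a, ∑ i, (if x i = a then (1 : ℝ≥0∞) else 0) = N := by
    rw [Summable.tsum_finsetSum fun _ _ => ENNReal.summable]
    have h1 : ∀ i : Fin N, ∑' a, (if x i = a then (1 : ℝ≥0∞) else 0) = 1 := fun i => by
      rw [tsum_eq_single (x i)]
      · simp
      · intro b hb; simp [hb.symm]
    simp [h1]
  rw [this]
  exact ENNReal.inv_mul_cancel natCast_size_ne_zero (ENNReal.natCast_ne_top N)

end Avg

namespace Model
variable {S : ℕ → Type u} (m : Model S) (s₀ : S 0)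

/-- The optimal proposal, proportional to `π_ref(y | x) V(x, y)`. -/
noncomputable def optProposal (t : ℕ) (x : Pref S t) : PMF (S (t + 1)) :=
  tilt (m.ref s₀ t x) (m.nextV s₀ t x)

/-- The one-step backward operator `F ↦ E[V(x, y) F(x, y)] / V(x)`. -/
noncomputable def pull (t : ℕ) (F : Pref S (t + 1) → ℝ≥0∞) (x : Pref S t) : ℝ≥0∞ :=
  expect (m.ref s₀ t x) (fun y => ENNReal.ofReal (m.nextV s₀ t x y) * F (x, y)) /
    ENNReal.ofReal (m.V s₀ t x)

/-- The exact incremental weight `E[V(x, y)] / V(x)`. -/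
noncomputable def weight (t : ℕ) (x : Pref S t) : ℝ≥0∞ := m.pull s₀ t (fun _ => 1) x

/-- The unnormalized target. -/
noncomputable def gamma (t : ℕ) (F : Pref S t → ℝ≥0∞) : ℝ≥0∞ :=
  expect (m.refLaw s₀ t) fun x => ENNReal.ofReal (m.V s₀ t x) * F x

theorem expect_refLaw_succ (t : ℕ) (f : Pref S (t + 1) → ℝ≥0∞) :
    expect (m.refLaw s₀ (t + 1)) f =
      expect (m.refLaw s₀ t) fun x => expect (m.ref s₀ t x) fun y => f (x, y) :=
  (expect_bind _ _ _).trans (congrArg _ (funext fun x => expect_map _ (fun y => (x, y)) f))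

theorem expect_histLaw_succ (N Nm n : ℕ) [NeZero N] (M : ℝ) (t : ℕ)
    (f : Hist S N Nm n (t + 1) → ℝ≥0∞) :
    expect (m.histLaw s₀ N Nm n M (t + 1)) f =
      expect (m.histLaw s₀ N Nm n M t) fun h =>
        expect (m.roundLaw s₀ t N Nm n M (particles t h)) fun r => f (h, r) :=
  (expect_bind _ _ _).trans (congrArg _ (funext fun h => expect_map _ (fun r => (h, r)) f))

variable {m s₀} {T : ℕ} {L ε : ℝ}

section Bounds
variable (hR : m.RatioBound s₀ T L) {t : ℕ} (ht : t < T)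
include hR ht

theorem RatioBound.nextV_le (x : Pref S t) (y : S (t + 1)) :
    m.nextV s₀ t x y ≤ L * m.V s₀ t x :=
  (div_le_iff₀ (hR.1 t ht.le x)).1 ((le_max_right _ _).trans (hR.2 t ht x y))

theorem RatioBound.nextV_pos (x : Pref S t) (y : S (t + 1)) : 0 < m.nextV s₀ t x y :=
  hR.1 (t + 1) ht (x, y)

theorem RatioBound.le_nextV (x : Pref S t) (y : S (t + 1)) :
    m.V s₀ t x ≤ L * m.nextV s₀ t x y :=
  (div_le_iff₀ (hR.nextV_pos ht x y)).1 ((le_max_left _ _).trans (hR.2 t ht x y))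

theorem RatioBound.expect_nextV_ne_top (x : Pref S t) :
    expect (m.ref s₀ t x) (fun y => ENNReal.ofReal (m.nextV s₀ t x y)) ≠ ∞ :=
  ne_top_of_le_ne_top (b := ENNReal.ofReal (L * m.V s₀ t x)) ENNReal.ofReal_ne_top <|
    expect_le _ fun y => ENNReal.ofReal_le_ofReal (hR.nextV_le ht x y)

theorem RatioBound.expect_nextV (x : Pref S t) :
    expect (m.ref s₀ t x) (fun y => ENNReal.ofReal (m.nextV s₀ t x y)) =
      ENNReal.ofReal (m.expNext s₀ t x) := by
  have h := hR.expect_nextV_ne_top ht x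
  rw [← ENNReal.ofReal_toReal h, expect,
    ENNReal.tsum_toReal_eq (ENNReal.ne_top_of_tsum_ne_top h), expNext]
  congr 2
  funext y
  rw [ENNReal.toReal_mul, ENNReal.toReal_ofReal (hR.nextV_pos ht x y).le]

theorem RatioBound.expNext_pos (hL : 0 < L) (x : Pref S t) : 0 < m.expNext s₀ t x := by
  rw [← ENNReal.ofReal_pos, ← hR.expect_nextV ht x]
  refine lt_of_lt_of_le (b := ENNReal.ofReal (m.V s₀ t x / L))
    (ENNReal.ofReal_pos.2 (div_pos (hR.1 t ht.le x) hL)) ?_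
  refine le_expect _ fun y => ENNReal.ofReal_le_ofReal ?_
  rw [div_le_iff₀ hL, mul_comm]
  exact hR.le_nextV ht x y

theorem RatioBound.weight_eq (x : Pref S t) :
    m.weight s₀ t x = ENNReal.ofReal (m.expNext s₀ t x / m.V s₀ t x) := by
  simp only [weight, pull, mul_one]
  rw [hR.expect_nextV ht x, ENNReal.ofReal_div_of_pos (hR.1 t ht.le x)]

theorem weight_le (hB : m.BellmanBound s₀ T ε) (x : Pref S t) :
    m.weight s₀ t x ≤ ENNReal.ofReal (1 + ε) := by
  rw [hR.weight_eq ht]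
  exact ENNReal.ofReal_le_ofReal ((le_max_right _ _).trans (hB t ht x))

/-- Together with `weight_le`, this is the Bellman bound read as closeness of the incremental weight
to `1`. The product form avoids inverses in `ℝ≥0∞`. -/
theorem one_le_mul_weight (hL : 0 < L) (hε : 0 ≤ ε) (hB : m.BellmanBound s₀ T ε) (x : Pref S t) :
    1 ≤ ENNReal.ofReal (1 + ε) * m.weight s₀ t x := by
  have hV := hR.1 t ht.le x
  have hZ := hR.expNext_pos ht hL x
  rw [hR.weight_eq ht, ← ENNReal.ofReal_mul (by linarith), ← ENNReal.ofReal_one]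
  refine ENNReal.ofReal_le_ofReal ?_
  have := (div_le_iff₀ hZ).1 ((le_max_left _ _).trans (hB t ht x))
  rw [← mul_div_assoc, le_div_iff₀ hV, one_mul]
  exact this

/-- The weight is the normalizer of the tilted law divided by `V x`, so the normalizer cancels.
Hence the correct weight depends only on the old prefix and not on the proposed state. -/
theorem weight_mul_expect_optProposal (hL : 0 < L) (x : Pref S t) (F : Pref S (t + 1) → ℝ≥0∞) :
    m.weight s₀ t x * expect (m.optProposal s₀ t x) (fun y => F (x, y)) = m.pull s₀ t F x := by
  have hZ := hR.expNext_pos ht hL x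
  have hZ0 : ENNReal.ofReal (m.expNext s₀ t x) ≠ 0 := by simpa using hZ
  simp only [weight, pull, mul_one]
  rw [ENNReal.div_eq_inv_mul, ENNReal.div_eq_inv_mul, mul_assoc]
  congr 1
  rw [hR.expect_nextV ht x, expect, ← ENNReal.tsum_mul_left]
  refine tsum_congr fun y => ?_
  rw [optProposal, tilt_apply _ _ (by rwa [hR.expect_nextV ht x])
    (hR.expect_nextV_ne_top ht x), hR.expect_nextV ht x, ← mul_assoc, ← mul_assoc,
    ENNReal.mul_div_cancel hZ0 ENNReal.ofReal_ne_top]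

/-- The factor `V x` in the unnormalized target cancels the denominator of `pull`, so the weights
telescope along the path. -/
theorem gamma_succ (F : Pref S (t + 1) → ℝ≥0∞) :
    m.gamma s₀ (t + 1) F = m.gamma s₀ t (m.pull s₀ t F) := by
  rw [gamma, expect_refLaw_succ, gamma]
  congr 1
  funext x
  rw [pull, ENNReal.mul_div_cancel (by simpa using hR.1 t ht.le x) ENNReal.ofReal_ne_top]
  rfl

end Bounds

/-! ### Weighted chains of particle systems -/

/-- The law of the particles and of the accumulated weight, for transition kernels that return the
new particles and a weight factor. -/
noncomputable def weightedLaw {N : ℕ}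
    (κ : (t : ℕ) → (Fin N → Pref S t) → PMF ((Fin N → Pref S (t + 1)) × ℝ≥0∞)) :
    (t : ℕ) → PMF ((Fin N → Pref S t) × ℝ≥0∞)
  | 0 => PMF.pure (fun _ => PUnit.unit, 1)
  | t + 1 => (weightedLaw κ t).bind fun p => (κ t p.1).map fun q => (q.1, p.2 * q.2)

variable (m s₀) in
/-- The kernel is unbiased: weighted means after a step average to the backward operator. -/
def Unbiased (T : ℕ) {N : ℕ}
    (κ : (t : ℕ) → (Fin N → Pref S t) → PMF ((Fin N → Pref S (t + 1)) × ℝ≥0∞)) : Prop :=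
  ∀ t < T, ∀ x (F : Pref S (t + 1) → ℝ≥0∞),
    expect (κ t x) (fun q => q.2 * avg F q.1) = avg (m.pull s₀ t F) x

section Chain
variable {N : ℕ} [NeZero N]
  {κ : (t : ℕ) → (Fin N → Pref S t) → PMF ((Fin N → Pref S (t + 1)) × ℝ≥0∞)}

omit [NeZero N] in
theorem expect_weightedLaw_succ (t : ℕ) (f : (Fin N → Pref S (t + 1)) × ℝ≥0∞ → ℝ≥0∞) :
    expect (weightedLaw κ (t + 1)) f =
      expect (weightedLaw κ t) fun p => expect (κ t p.1) fun q => f (q.1, p.2 * q.2) := by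
  simp only [weightedLaw, expect_bind, expect_map]

/-- Unbiasedness of sequential Monte Carlo: one-step unbiasedness iterates because `gamma` evolves
by `pull`. The factor `V` of the empty prefix appears because accumulated weights start at `1`. -/
theorem Unbiased.expect_weightedLaw (hR : m.RatioBound s₀ T L) (hκ : m.Unbiased s₀ T κ) {t : ℕ}
    (ht : t ≤ T) (F : Pref S t → ℝ≥0∞) :
    ENNReal.ofReal (m.V s₀ 0 PUnit.unit) *
      expect (weightedLaw κ t) (fun p => p.2 * avg F p.1) = m.gamma s₀ t F := by
  induction t with
  | zero =>
    simp only [weightedLaw, expect_pure, gamma, refLaw, one_mul]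
    refine Eq.trans ?_ (expect_pure _ _).symm
    exact congrArg (_ * ·) (avg_const (N := N) (F PUnit.unit) fun _ => PUnit.unit)
  | succ t ih =>
    rw [gamma_succ hR ht, ← ih (Nat.le_of_succ_le ht), expect_weightedLaw_succ]
    simp only [mul_assoc, expect_mul_left, hκ t ht]

/-- The one-round comparison compounds by the Markov property. The weight drops out, since it never
influences the particles. -/
theorem le_expect_histLaw {Nm n : ℕ} {M : ℝ} {θ : ℝ≥0∞}
    (hθ : ∀ t < T, ∀ x (f : (Fin N → Pref S (t + 1)) → ℝ≥0∞),
      θ * expect (κ t x) (fun q => f q.1) ≤ expect (m.roundLaw s₀ t N Nm n M x)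
        fun r => f fun i => (x (r.anc i), (r.rs (r.anc i)).out))
    {t : ℕ} (ht : t ≤ T) (f : (Fin N → Pref S t) → ℝ≥0∞) :
    θ ^ t * expect (weightedLaw κ t) (fun p => f p.1) ≤
      expect (m.histLaw s₀ N Nm n M t) fun h => f (particles t h) := by
  induction t with
  | zero =>
    rw [pow_zero, one_mul, weightedLaw, expect_pure]
    exact (expect_pure _ _).ge
  | succ t ih =>
    rw [expect_weightedLaw_succ, pow_succ, mul_assoc, ← expect_mul_left]
    rw [expect_histLaw_succ]
    refine le_trans ?_ (ih (Nat.le_of_succ_le ht) fun x =>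
      expect (m.roundLaw s₀ t N Nm n M x) fun r => f fun i => (x (r.anc i), (r.rs (r.anc i)).out))
    gcongr
    exact expect_mono _ fun p => hθ t ht _ f

/-- The distance of the output law to the target is controlled by the overlap of the accumulated
weight, relative to its mean, with the constant `1`. -/
theorem tvDist_target_smc_le (hR : m.RatioBound s₀ T L) (hκ : m.Unbiased s₀ T κ) {Nm : ℕ}
    {M δ' d : ℝ} (hd : 0 ≤ d) {θ Z : ℝ≥0∞} (hθ1 : θ ≤ 1)
    (hθ : ∀ t < T, ∀ x (f : (Fin N → Pref S (t + 1)) → ℝ≥0∞),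
      θ * expect (κ t x) (fun q => f q.1) ≤ expect (m.roundLaw s₀ t N Nm (rsBudget M δ') M x)
        fun r => f fun i => (x (r.anc i), (r.rs (r.anc i)).out))
    (hZ : expect (weightedLaw κ T) (fun p => p.2) = Z) (hZ0 : Z ≠ 0) (hZ1 : Z ≠ ∞)
    (hover : 1 ≤ θ ^ T * expect (weightedLaw κ T) (fun p => min (p.2 / Z) 1) +
      ENNReal.ofReal d) :
    tvDist (m.target s₀ T) ((m.smc s₀ T N Nm M δ').map Run.out) ≤ d := by
  classical
  set ind : Pref S T → Pref S T → ℝ≥0∞ := fun a b => if b = a then 1 else 0 with hind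
  have hV0 : ENNReal.ofReal (m.V s₀ 0 PUnit.unit) ≠ 0 := by
    simpa using hR.1 0 (Nat.zero_le _) PUnit.unit
  have hg1 : m.gamma s₀ T (fun _ => 1) = ENNReal.ofReal (m.V s₀ 0 PUnit.unit) * Z := by
    rw [← hκ.expect_weightedLaw hR le_rfl, ← hZ]
    simp only [avg_const, mul_one]
  have hsum : expect (m.refLaw s₀ T) (fun a => ENNReal.ofReal (m.V s₀ T a)) =
      ENNReal.ofReal (m.V s₀ 0 PUnit.unit) * Z := by
    rw [← hg1, gamma]; simp only [mul_one]
  -- The minorant is the mean of `min (W / Z) 1` times the empirical measure. Below, the target is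
  -- written with `W / Z` in place of the minimum, and the output law with `1`.
  refine tvDist_le_of_minorant (m := fun a => θ ^ T *
    expect (weightedLaw κ T) fun p => min (p.2 / Z) 1 * avg (ind a) p.1) hd ?_ ?_ ?_
  · intro a
    have htarget : m.target s₀ T a =
        expect (weightedLaw κ T) (fun p => p.2 / Z * avg (ind a) p.1) := by
      rw [target, tilt_apply _ _ (by rw [hsum]; exact mul_ne_zero hV0 hZ0)
        (by rw [hsum]; exact ENNReal.mul_ne_top ENNReal.ofReal_ne_top hZ1), hsum]
      have h1 : m.gamma s₀ T (ind a) = m.refLaw s₀ T a * ENNReal.ofReal (m.V s₀ T a) := by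
        rw [gamma, expect, tsum_eq_single a]
        · simp [hind]
        · intro b hb; simp [hind, hb]
      rw [← h1, ← hκ.expect_weightedLaw hR le_rfl,
        ENNReal.mul_div_mul_left _ _ hV0 ENNReal.ofReal_ne_top, ENNReal.div_eq_inv_mul,
        ← expect_mul_left]
      simp only [ENNReal.div_eq_inv_mul, mul_assoc]
    rw [htarget]
    refine (mul_le_of_le_one_left' (pow_le_one₀ bot_le hθ1)).trans (expect_mono _ fun p => ?_)
    gcongr
    exact min_le_left _ _
  · intro a
    rw [apply_eq_expect, expect_map, smc, expect_bind]
    simp only [expect_map, expect_uniform]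
    refine le_trans ?_ (le_expect_histLaw hθ le_rfl (avg (ind a)))
    gcongr
    exact expect_mono _ fun p => mul_le_of_le_one_left' (min_le_right _ _)
  · rw [ENNReal.tsum_mul_left, ← expect_tsum]
    simpa only [ENNReal.tsum_mul_left, hind, tsum_avg_indicator, mul_one] using hover

end Chain

/-! ### The idealized round -/

section Ideal
variable (m s₀)

/-- The Monte-Carlo estimate of the incremental weight of a particle. -/
noncomputable def mcWeight {Nm : ℕ} (t : ℕ) (x : Pref S t) (y : Fin Nm → S (t + 1)) : ℝ :=
  ((∑ k, m.nextV s₀ t x (y k)) / Nm) / m.V s₀ t x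

/-- A round with exact draws from the optimal proposal, and with weight factor `c`. -/
noncomputable def idealRound (N Nm : ℕ) [NeZero N]
    (c : (t : ℕ) → (Fin N → Pref S t) → (Fin N → Fin Nm → S (t + 1)) → ℝ≥0∞)
    (t : ℕ) (x : Fin N → Pref S t) : PMF ((Fin N → Pref S (t + 1)) × ℝ≥0∞) :=
  (indep N fun i => m.optProposal s₀ t (x i)).bind fun ys =>
    (indep N fun j => indep Nm fun _ => m.ref s₀ t (x j)).bind fun mc =>
      (indep N fun _ => categorical fun j => m.mcWeight s₀ t (x j) (mc j)).map fun anc =>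
        (fun i => (x (anc i), ys (anc i)), c t x mc)

variable {m s₀} {N Nm : ℕ} [NeZero N]
  {c : (t : ℕ) → (Fin N → Pref S t) → (Fin N → Fin Nm → S (t + 1)) → ℝ≥0∞}

theorem expect_idealRound {t : ℕ} (x : Fin N → Pref S t)
    (f : (Fin N → Pref S (t + 1)) × ℝ≥0∞ → ℝ≥0∞) :
    expect (m.idealRound s₀ N Nm c t x) f =
      expect (indep N fun i => m.optProposal s₀ t (x i)) fun ys =>
        expect (indep N fun j => indep Nm fun _ => m.ref s₀ t (x j)) fun mc =>
          expect (indep N fun _ => categorical fun j => m.mcWeight s₀ t (x j) (mc j)) fun anc =>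
            f (fun i => (x (anc i), ys (anc i)), c t x mc) := by
  simp only [idealRound, expect_bind, expect_map]

/-- Only the `N` rejection-sampling calls differ between the two rounds. The threshold fits because
the score is at most `L V`, hence at most `L (1 + ε)` times its mean; `a` is any upper bound for
`ε`, which lets the threshold depend on `c₁` rather than `ε`. -/
theorem idealRound_dominated (hR : m.RatioBound s₀ T L) (hB : m.BellmanBound s₀ T ε)
    (hL : 0 < L) (hε : 0 ≤ ε) {a : ℝ} (hεa : ε ≤ a) {δ' : ℝ} (hδ0 : 0 < δ') (hδ1 : δ' ≤ 1)
    {t : ℕ} (ht : t < T) (x : Fin N → Pref S t) (f : (Fin N → Pref S (t + 1)) → ℝ≥0∞) :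
    ENNReal.ofReal (1 - δ') ^ N * expect (m.idealRound s₀ N Nm c t x) (fun q => f q.1) ≤
      expect (m.roundLaw s₀ t N Nm (rsBudget (4 * (L * (1 + a))) δ') (4 * (L * (1 + a))) x)
        fun r => f fun i => (x (r.anc i), (r.rs (r.anc i)).out) := by
  rw [expect_idealRound]
  simp only [roundLaw, expect_bind, expect_map]
  refine expect_indep_le_of_dominated (k := RSRun.out) (fun i F => ?_) fun ys =>
    expect (indep N fun j => indep Nm fun _ => m.ref s₀ t (x j)) fun mc =>
      expect (indep N fun _ => categorical fun j => m.mcWeight s₀ t (x j) (mc j)) fun anc =>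
        f fun i => (x (anc i), ys (anc i))
  refine tilt_le_rejectionSampling _ (fun y => (hR.nextV_pos ht _ y).le) (hR.expect_nextV ht _)
    (hR.expNext_pos ht hL _) (mul_pos hL (by linarith)) (fun y => ?_) hδ0 hδ1 F
  have hZ := hR.expNext_pos ht hL (x i)
  have h1 := (div_le_iff₀ hZ).1 ((le_max_left _ _).trans (hB t ht (x i)))
  calc m.nextV s₀ t (x i) y ≤ L * m.V s₀ t (x i) := hR.nextV_le ht _ y
    _ ≤ L * ((1 + a) * m.expNext s₀ t (x i)) := by
        gcongr
        exact h1.trans (by gcongr)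
    _ = _ := by ring

end Ideal
end Model
-- Multiplying by the total weight undoes the random denominator of resampling. This is why the mean
-- weight is the correct factor to accumulate.
theorem expect_categorical_mul {N : ℕ} [NeZero N] {w : Fin N → ℝ} (hw : ∀ j, 0 < w j)
    (f : Fin N → ℝ≥0∞) :
    (∑ j, ENNReal.ofReal (w j)) * expect (categorical w) f = ∑ j, ENNReal.ofReal (w j) * f j := by
  have h0 : ∑ j, ENNReal.ofReal (w j) ≠ 0 := fun h => by
    have := Finset.sum_eq_zero_iff.1 h 0 (Finset.mem_univ _)
    exact (ENNReal.ofReal_pos.2 (hw 0)).ne' this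
  have h1 : ∑ j, ENNReal.ofReal (w j) ≠ ∞ := by simp
  rw [expect, tsum_fintype, Finset.mul_sum]
  refine Finset.sum_congr rfl fun j _ => ?_
  rw [categorical, normalizeOr_apply _ _ (by rwa [tsum_fintype]) (by rwa [tsum_fintype]),
    tsum_fintype, ← mul_assoc, ENNReal.mul_div_cancel h0 h1]

/-- A variable of mean `1` and second moment `1 + η` overlaps with the constant `1` up to
`√η / 2`. -/
theorem one_le_expect_min_add {α : Type*} (p : PMF α) (X : α → ℝ≥0∞) {η l : ℝ} (hl : 0 < l)
    (hη0 : 0 ≤ η) (hη : η ≤ l ^ 2) (h1 : expect p X = 1)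
    (h2 : expect p (fun a => X a ^ 2) ≤ ENNReal.ofReal (1 + η)) :
    1 ≤ expect p (fun a => min (X a) 1) + ENNReal.ofReal (l / 2) := by
  -- This is `2 l |X - 1| ≤ (X - 1) ^ 2 + l ^ 2` with `|X - 1| = X + 1 - 2 min X 1`, rearranged so
  -- that no subtraction occurs in `ℝ≥0∞`.
  have hpt : ∀ a, ENNReal.ofReal (2 * l) + ENNReal.ofReal (2 * l + 2) * X a ≤
      ENNReal.ofReal (4 * l) * min (X a) 1 + ENNReal.ofReal (l ^ 2 + 1) + X a ^ 2 := fun a => by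
    rcases eq_or_ne (X a) ∞ with h | h
    · simp [h]
    · lift X a to ℝ≥0 using h with x
      have hx : (x : ℝ≥0∞) = ENNReal.ofReal x := ENNReal.ofReal_coe_nnreal.symm
      have hx0 : (0 : ℝ) ≤ x := x.2
      rw [hx, ← ENNReal.ofReal_one, ← ENNReal.ofReal_min, ← ENNReal.ofReal_pow hx0,
        ← ENNReal.ofReal_mul (by positivity), ← ENNReal.ofReal_mul (by positivity),
        ← ENNReal.ofReal_add (by positivity) (by positivity),
        ← ENNReal.ofReal_add (by positivity) (by positivity),
        ← ENNReal.ofReal_add (by positivity) (by positivity)]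
      refine ENNReal.ofReal_le_ofReal ?_
      rcases le_total (x : ℝ) 1 with h | h
      · rw [min_eq_left h]; nlinarith [sq_nonneg ((x : ℝ) - 1 + l)]
      · rw [min_eq_right h]; nlinarith [sq_nonneg ((x : ℝ) - 1 - l)]
  have h := expect_mono p hpt
  rw [expect_add, expect_add, expect_add, expect_const, expect_const, expect_mul_left,
    expect_mul_left, h1, mul_one] at h
  replace h := h.trans (add_le_add_right h2 _)
  have hm : expect p (fun a => min (X a) 1) ≤ 1 := expect_le _ fun a => min_le_right _ _
  have hm' : expect p (fun a => min (X a) 1) ≠ ∞ := ne_top_of_le_ne_top ENNReal.one_ne_top hm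
  rw [← ENNReal.ofReal_toReal hm'] at h ⊢
  set e := (expect p (fun a => min (X a) 1)).toReal with he
  have he0 : 0 ≤ e := ENNReal.toReal_nonneg
  rw [← ENNReal.ofReal_mul (by positivity), ← ENNReal.ofReal_add (by positivity) (by positivity),
    ← ENNReal.ofReal_add (by positivity) (by positivity),
    ← ENNReal.ofReal_add (by positivity) (by positivity),
    ENNReal.ofReal_le_ofReal_iff (by positivity)] at h
  rw [← ENNReal.ofReal_add (by positivity) (by positivity), ← ENNReal.ofReal_one]
  refine ENNReal.ofReal_le_ofReal ?_
  have : l * 1 ≤ l * (e + l / 2) := by nlinarith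
  exact le_of_mul_le_mul_left this hl

namespace Model
variable {S : ℕ → Type u} {m : Model S} {s₀ : S 0} {T : ℕ} {L ε : ℝ}

/-! ### Monte-Carlo weights -/

theorem mcWeight_pos (hR : m.RatioBound s₀ T L) {Nm : ℕ} (hNm : 0 < Nm) {t : ℕ} (ht : t < T)
    (x : Pref S t) (y : Fin Nm → S (t + 1)) : 0 < m.mcWeight s₀ t x y := by
  have : Nonempty (Fin Nm) := ⟨⟨0, hNm⟩⟩
  refine div_pos (div_pos (Finset.sum_pos (fun k _ => hR.nextV_pos ht x _)
    Finset.univ_nonempty) (by exact_mod_cast hNm)) (hR.1 t ht.le x)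

theorem ofReal_mcWeight (hR : m.RatioBound s₀ T L) {Nm : ℕ} (hNm : 0 < Nm) {t : ℕ} (ht : t < T)
    (x : Pref S t) (y : Fin Nm → S (t + 1)) :
    ENNReal.ofReal (m.mcWeight s₀ t x y) =
      (Nm : ℝ≥0∞)⁻¹ * (ENNReal.ofReal (m.V s₀ t x))⁻¹ *
        ∑ k, ENNReal.ofReal (m.nextV s₀ t x (y k)) := by
  rw [mcWeight, ENNReal.ofReal_div_of_pos (hR.1 t ht.le x),
    ENNReal.ofReal_div_of_pos (by exact_mod_cast hNm),
    ENNReal.ofReal_sum_of_nonneg fun k _ => (hR.nextV_pos ht x _).le, ENNReal.ofReal_natCast,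
    div_eq_mul_inv, div_eq_mul_inv]
  ring

theorem expect_nextV_eq (hR : m.RatioBound s₀ T L) {t : ℕ} (ht : t < T) (x : Pref S t) :
    expect (m.ref s₀ t x) (fun y => ENNReal.ofReal (m.nextV s₀ t x y)) =
      ENNReal.ofReal (m.V s₀ t x) * m.weight s₀ t x := by
  simp only [weight, pull, mul_one]
  rw [ENNReal.mul_div_cancel (by simpa using hR.1 t ht.le x) ENNReal.ofReal_ne_top]

theorem expect_mcWeight (hR : m.RatioBound s₀ T L) {Nm : ℕ} (hNm : 0 < Nm) {t : ℕ} (ht : t < T)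
    (x : Pref S t) :
    expect (indep Nm fun _ => m.ref s₀ t x) (fun y => ENNReal.ofReal (m.mcWeight s₀ t x y)) =
      m.weight s₀ t x := by
  simp only [ofReal_mcWeight hR hNm ht, expect_mul_left]
  rw [expect_indep_sum (fun _ => m.ref s₀ t x) fun _ y => ENNReal.ofReal (m.nextV s₀ t x y)]
  simp only [expect_nextV_eq hR ht, Finset.sum_const, Finset.card_univ, Fintype.card_fin,
    nsmul_eq_mul]
  have h1 : (Nm : ℝ≥0∞)⁻¹ * Nm = 1 :=
    ENNReal.inv_mul_cancel (by simpa using hNm.ne') (ENNReal.natCast_ne_top _)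
  have h2 : (ENNReal.ofReal (m.V s₀ t x))⁻¹ * ENNReal.ofReal (m.V s₀ t x) = 1 :=
    ENNReal.inv_mul_cancel (by simpa using hR.1 t ht.le x) ENNReal.ofReal_ne_top
  calc _ = (Nm : ℝ≥0∞)⁻¹ * Nm * ((ENNReal.ofReal (m.V s₀ t x))⁻¹ * ENNReal.ofReal (m.V s₀ t x))
        * m.weight s₀ t x := by ring
    _ = _ := by rw [h1, h2, one_mul, one_mul]

/-- With `L` samples, the Monte-Carlo weight has bounded second moment. -/
theorem expect_mcWeight_sq_le (hR : m.RatioBound s₀ T L) (hL : 0 ≤ L) {Nm : ℕ} (hNm : 0 < Nm)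
    (hLN : L ≤ Nm) {t : ℕ} (ht : t < T) (x : Pref S t) :
    expect (indep Nm fun _ => m.ref s₀ t x)
      (fun y => ENNReal.ofReal (m.mcWeight s₀ t x y) ^ 2) ≤
      m.weight s₀ t x + m.weight s₀ t x ^ 2 := by
  set w := m.weight s₀ t x with hw
  set v := ENNReal.ofReal (m.V s₀ t x) with hv
  have h1 : (Nm : ℝ≥0∞)⁻¹ * Nm = 1 :=
    ENNReal.inv_mul_cancel (by simpa using hNm.ne') (ENNReal.natCast_ne_top _)
  have h2 : v⁻¹ * v = 1 :=
    ENNReal.inv_mul_cancel (by simpa [hv] using hR.1 t ht.le x) ENNReal.ofReal_ne_top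
  -- One factor of the square is bounded by `L V ≤ Nm V`. The surplus `Nm` then cancels against the
  -- averaging.
  have hsq : expect (m.ref s₀ t x) (fun y => ENNReal.ofReal (m.nextV s₀ t x y) ^ 2) ≤
      Nm * v * (v * w) := by
    rw [← expect_nextV_eq hR ht, ← expect_mul_left]
    refine expect_mono _ fun y => ?_
    rw [sq]
    gcongr
    calc ENNReal.ofReal (m.nextV s₀ t x y) ≤ ENNReal.ofReal (L * m.V s₀ t x) :=
          ENNReal.ofReal_le_ofReal (hR.nextV_le ht x y)
      _ = ENNReal.ofReal L * v := ENNReal.ofReal_mul hL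
      _ ≤ Nm * v := by
          gcongr
          rw [← ENNReal.ofReal_natCast]
          exact ENNReal.ofReal_le_ofReal hLN
  simp only [ofReal_mcWeight hR hNm ht, mul_pow, expect_mul_left]
  refine (mul_le_mul_right (expect_indep_sum_sq_le (fun _ => m.ref s₀ t x)
    fun _ y => ENNReal.ofReal (m.nextV s₀ t x y)) _).trans ?_
  simp only [expect_nextV_eq hR ht, Finset.sum_const, Finset.card_univ, Fintype.card_fin,
    nsmul_eq_mul]
  calc _ ≤ (Nm : ℝ≥0∞)⁻¹ ^ 2 * v⁻¹ ^ 2 * (Nm * (Nm * v * (v * w)) + (Nm * (v * w)) ^ 2) := by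
        gcongr
    _ = ((Nm : ℝ≥0∞)⁻¹ * Nm) ^ 2 * (v⁻¹ * v) ^ 2 * (w + w ^ 2) := by ring
    _ = _ := by rw [h1, h2, one_pow, one_mul, one_mul]

/-! ### The mean-weight factor -/

section MeanWeight
variable (m s₀) in
/-- The mean Monte-Carlo weight of the particles. -/
noncomputable def meanWeight {N Nm : ℕ} (t : ℕ) (x : Fin N → Pref S t)
    (mc : Fin N → Fin Nm → S (t + 1)) : ℝ≥0∞ :=
  (∑ j, ENNReal.ofReal (m.mcWeight s₀ t (x j) (mc j))) / N

variable {N Nm : ℕ} [NeZero N]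

/-- The three sources of randomness are averaged from the inside out: the mean weight cancels the
resampling denominator, the Monte-Carlo weights are unbiased and independent of the proposals, and
the exact weight cancels the normalizer of the proposal. -/
theorem meanWeight_unbiased (hR : m.RatioBound s₀ T L) (hL : 0 < L) (hNm : 0 < Nm) :
    m.Unbiased s₀ T (m.idealRound s₀ N Nm (m.meanWeight s₀)) := by
  intro t ht x F
  have hN : (N : ℝ≥0∞)⁻¹ * N = 1 :=
    ENNReal.inv_mul_cancel natCast_size_ne_zero (ENNReal.natCast_ne_top _)
  rw [expect_idealRound]
  simp only [avg, meanWeight, ENNReal.div_eq_inv_mul, expect_mul_left]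
  have hanc : ∀ (ys : Fin N → S (t + 1)) (mc : Fin N → Fin Nm → S (t + 1)),
      (N : ℝ≥0∞)⁻¹ * (∑ j, ENNReal.ofReal (m.mcWeight s₀ t (x j) (mc j))) * ((N : ℝ≥0∞)⁻¹ *
        expect (indep N fun _ => categorical fun j => m.mcWeight s₀ t (x j) (mc j))
          fun anc => ∑ i, F (x (anc i), ys (anc i))) =
      (N : ℝ≥0∞)⁻¹ * ∑ j, ENNReal.ofReal (m.mcWeight s₀ t (x j) (mc j)) * F (x j, ys j) := by
    intro ys mc
    rw [expect_indep_sum (fun _ => categorical fun j => m.mcWeight s₀ t (x j) (mc j))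
      fun _ j => F (x j, ys j), Finset.sum_const, Finset.card_univ, Fintype.card_fin,
      nsmul_eq_mul, ← expect_categorical_mul fun j => mcWeight_pos hR hNm ht (x j) (mc j),
      ← mul_assoc (N : ℝ≥0∞)⁻¹ (N : ℝ≥0∞), hN, one_mul, mul_assoc]
  simp only [hanc, expect_mul_left]
  congr 1
  have hmc : ∀ ys : Fin N → S (t + 1),
      expect (indep N fun j => indep Nm fun _ => m.ref s₀ t (x j))
        (fun mc => ∑ j, ENNReal.ofReal (m.mcWeight s₀ t (x j) (mc j)) * F (x j, ys j)) =
      ∑ j, m.weight s₀ t (x j) * F (x j, ys j) := fun ys => by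
    rw [expect_indep_sum (fun j => indep Nm fun _ => m.ref s₀ t (x j))
      fun j y => ENNReal.ofReal (m.mcWeight s₀ t (x j) y) * F (x j, ys j)]
    simp only [expect_mul_right, expect_mcWeight hR hNm ht]
  simp only [hmc]
  rw [expect_indep_sum (fun i => m.optProposal s₀ t (x i))
    fun j y => m.weight s₀ t (x j) * F (x j, y)]
  simp only [expect_mul_left, weight_mul_expect_optProposal hR ht hL]

/-- One round increases the relative second moment of the weighted mean of a function bounded
above and below by a factor `1 + O(1 / N)`. -/
theorem expect_meanWeight_sq_le (hR : m.RatioBound s₀ T L) (hL : 0 < L) (hNm : 0 < Nm)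
    (hLN : L ≤ Nm) {b : ℝ≥0∞} (hb : 1 ≤ b) {t : ℕ} (ht : t < T)
    (hw : ∀ x, m.weight s₀ t x ≤ b) (hw' : ∀ x, 1 ≤ b * m.weight s₀ t x)
    {F : Pref S (t + 1) → ℝ≥0∞} (hF : ∀ x, F x ≤ b) (hF' : ∀ x, 1 ≤ b * F x)
    (x : Fin N → Pref S t) :
    expect (m.idealRound s₀ N Nm (m.meanWeight s₀) t x) (fun q => (q.2 * avg F q.1) ^ 2) ≤
      (1 + 7 * b ^ 12 / N) * avg (m.pull s₀ t F) x ^ 2 := by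
  set a : ℝ≥0∞ := (N : ℝ≥0∞)⁻¹ with ha
  have hN : a * N = 1 :=
    ENNReal.inv_mul_cancel natCast_size_ne_zero (ENNReal.natCast_ne_top _)
  have ha1 : a ≤ 1 := ENNReal.inv_le_one.2 (by exact_mod_cast NeZero.one_le)
  rw [expect_idealRound]
  simp only [avg, meanWeight, ENNReal.div_eq_inv_mul, ← ha, mul_pow, expect_mul_left]
  set W : Fin N → (Fin N → Fin Nm → S (t + 1)) → ℝ≥0∞ :=
    fun j mc => ENNReal.ofReal (m.mcWeight s₀ t (x j) (mc j)) with hW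
  -- Resampling costs a relative factor `1 + b ^ 4 / N`. The estimates `hmc` and `hys` then bound
  -- the noise of the weights and of the proposals additively.
  have hanc : ∀ (ys : Fin N → S (t + 1)) (mc : Fin N → Fin Nm → S (t + 1)),
      a ^ 2 * (∑ j, W j mc) ^ 2 * (a ^ 2 *
        expect (indep N fun _ => categorical fun j => m.mcWeight s₀ t (x j) (mc j))
          fun anc => (∑ i, F (x (anc i), ys (anc i))) ^ 2) ≤
      (1 + a * b ^ 4) * (a ^ 2 * (∑ j, W j mc * F (x j, ys j)) ^ 2) := by
    intro ys mc
    set p := categorical fun j => m.mcWeight s₀ t (x j) (mc j) with hp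
    have hcat : (∑ j, W j mc) * expect p (fun j => F (x j, ys j)) = ∑ j, W j mc * F (x j, ys j) :=
      expect_categorical_mul (fun j => mcWeight_pos hR hNm ht (x j) (mc j)) _
    have hWF : ∑ j, W j mc ≤ b * ∑ j, W j mc * F (x j, ys j) := by
      rw [Finset.mul_sum]
      refine Finset.sum_le_sum fun j _ => ?_
      calc W j mc = W j mc * 1 := (mul_one _).symm
        _ ≤ W j mc * (b * F (x j, ys j)) := by gcongr; exact hF' _
        _ = _ := by ring
    have h := expect_indep_sum_sq_le (fun _ : Fin N => p) fun _ j => F (x j, ys j)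
    simp only [Finset.sum_const, Finset.card_univ, Fintype.card_fin, nsmul_eq_mul] at h
    have hF2 : expect p (fun j => F (x j, ys j) ^ 2) ≤ b ^ 2 :=
      expect_le _ fun j => by gcongr; exact hF _
    calc _ ≤ a ^ 2 * (∑ j, W j mc) ^ 2 * (a ^ 2 * (N * b ^ 2 +
          (N * expect p (fun j => F (x j, ys j))) ^ 2)) := by gcongr; exact h.trans (by gcongr)
      _ = (a * N) * a ^ 3 * (∑ j, W j mc) ^ 2 * b ^ 2 + (a * N) ^ 2 * a ^ 2 *
          ((∑ j, W j mc) * expect p (fun j => F (x j, ys j))) ^ 2 := by ring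
      _ ≤ a ^ 3 * (b * ∑ j, W j mc * F (x j, ys j)) ^ 2 * b ^ 2 +
          a ^ 2 * (∑ j, W j mc * F (x j, ys j)) ^ 2 := by
          rw [hN, hcat, one_mul, one_pow, one_mul]; gcongr
      _ = _ := by ring
  have hmc : ∀ ys : Fin N → S (t + 1),
      expect (indep N fun j => indep Nm fun _ => m.ref s₀ t (x j))
        (fun mc => (∑ j, W j mc * F (x j, ys j)) ^ 2) ≤
      N * (2 * b ^ 4) + (∑ j, m.weight s₀ t (x j) * F (x j, ys j)) ^ 2 := fun ys => by
    refine (expect_indep_sum_sq_le (fun j => indep Nm fun _ => m.ref s₀ t (x j))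
      fun j y => ENNReal.ofReal (m.mcWeight s₀ t (x j) y) * F (x j, ys j)).trans ?_
    simp only [mul_pow, expect_mul_right, expect_mcWeight hR hNm ht]
    gcongr
    calc _ ≤ ∑ _j : Fin N, 2 * b ^ 4 := by
          refine Finset.sum_le_sum fun j _ => ?_
          calc _ ≤ (m.weight s₀ t (x j) + m.weight s₀ t (x j) ^ 2) * b ^ 2 := by
                gcongr
                · exact expect_mcWeight_sq_le hR hL.le hNm hLN ht (x j)
                · exact hF _
            _ ≤ (b ^ 2 + b ^ 2) * b ^ 2 := by
                gcongr
                · exact (hw _).trans (le_self_pow₀ hb two_ne_zero)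
                · exact hw _
            _ = _ := by ring
      _ = _ := by simp
  have hys : expect (indep N fun i => m.optProposal s₀ t (x i))
        (fun ys => (∑ j, m.weight s₀ t (x j) * F (x j, ys j)) ^ 2) ≤
      N * b ^ 4 + (∑ j, m.pull s₀ t F (x j)) ^ 2 := by
    refine (expect_indep_sum_sq_le (fun i => m.optProposal s₀ t (x i))
      fun j y => m.weight s₀ t (x j) * F (x j, y)).trans ?_
    simp only [mul_pow, expect_mul_left, weight_mul_expect_optProposal hR ht hL]
    gcongr
    calc _ ≤ ∑ _j : Fin N, b ^ 4 := by
          refine Finset.sum_le_sum fun j _ => ?_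
          calc _ ≤ b ^ 2 * b ^ 2 := by
                gcongr
                · exact hw _
                · exact expect_le _ fun y => by gcongr; exact hF _
            _ = _ := by ring
      _ = _ := by simp
  -- The particle mean of `pull F` is at least `b ^ (-2)`, which converts the additive errors into
  -- relative ones.
  have hlow : 1 ≤ b ^ 2 * (a * ∑ j, m.pull s₀ t F (x j)) := by
    have : ∀ j, 1 ≤ b ^ 2 * m.pull s₀ t F (x j) := fun j => by
      rw [← weight_mul_expect_optProposal hR ht hL]
      calc (1 : ℝ≥0∞) ≤ (b * m.weight s₀ t (x j)) * (b *
            expect (m.optProposal s₀ t (x j)) fun y => F (x j, y)) := by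
            refine one_le_mul (hw' _) ?_
            rw [← expect_mul_left]
            exact le_expect _ fun y => hF' _
        _ = _ := by ring
    calc (1 : ℝ≥0∞) = a * ∑ _j : Fin N, 1 := by simp [hN]
      _ ≤ a * ∑ j, b ^ 2 * m.pull s₀ t F (x j) := by gcongr; exact this _
      _ = _ := by rw [← Finset.mul_sum]; ring
  set P := ∑ j, m.pull s₀ t F (x j) with hP
  calc _ ≤ expect (indep N fun i => m.optProposal s₀ t (x i)) fun ys =>
        expect (indep N fun j => indep Nm fun _ => m.ref s₀ t (x j)) fun mc =>
          (1 + a * b ^ 4) * (a ^ 2 * (∑ j, W j mc * F (x j, ys j)) ^ 2) :=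
        expect_mono _ fun ys => expect_mono _ fun mc => hanc ys mc
    _ ≤ (1 + a * b ^ 4) * (a ^ 2 * (N * (2 * b ^ 4) + (N * b ^ 4 + P ^ 2))) := by
        simp only [expect_mul_left]
        gcongr
        refine (expect_mono _ hmc).trans ?_
        rw [expect_add, expect_const]
        gcongr
    _ = (1 + a * b ^ 4) * ((a * N) * a * (3 * b ^ 4) + (a * P) ^ 2) := by ring
    _ ≤ (1 + a * b ^ 4) * (a * (3 * b ^ 4) * (b ^ 2 * (a * P)) ^ 2 + (a * P) ^ 2) := by
        rw [hN, one_mul]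
        gcongr (1 + a * b ^ 4) * (?_ + (a * P) ^ 2)
        exact le_mul_of_one_le_right' (one_le_pow₀ hlow)
    _ = (1 + a * (b ^ 4 + 3 * b ^ 8 + a * (3 * b ^ 12))) * (a * P) ^ 2 := by ring
    -- All powers of `b` are raised to `12` and one factor `a ≤ 1` is dropped; `7 = 1 + 3 + 3`.
    _ ≤ (1 + a * (b ^ 12 + 3 * b ^ 12 + 1 * (3 * b ^ 12))) * (a * P) ^ 2 := by
        gcongr <;> first | exact hb | norm_num
    _ = _ := by ring

end MeanWeight

/-! ### The lookahead function and the normalizing constant -/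

variable (m s₀) in
/-- `E[V(s_{1:t+r}) | s_{1:t}] / V(s_{1:t})`. -/
noncomputable def lookahead : (r t : ℕ) → Pref S t → ℝ≥0∞
  | 0, _ => fun _ => 1
  | r + 1, t => m.pull s₀ t (lookahead r (t + 1))

theorem pull_le (hR : m.RatioBound s₀ T L) (hL : 0 < L) {t : ℕ} (ht : t < T) {a c : ℝ≥0∞}
    (x : Pref S t) (hw : m.weight s₀ t x ≤ a) {F : Pref S (t + 1) → ℝ≥0∞} (hF : ∀ x, F x ≤ c) :
    m.pull s₀ t F x ≤ a * c := by
  rw [← weight_mul_expect_optProposal hR ht hL]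
  gcongr
  exact expect_le _ fun y => hF _

theorem one_le_mul_pull (hR : m.RatioBound s₀ T L) (hL : 0 < L) {t : ℕ} (ht : t < T)
    {a c : ℝ≥0∞} (x : Pref S t) (hw : 1 ≤ a * m.weight s₀ t x) {F : Pref S (t + 1) → ℝ≥0∞}
    (hF : ∀ x, 1 ≤ c * F x) : 1 ≤ a * c * m.pull s₀ t F x := by
  rw [← weight_mul_expect_optProposal hR ht hL, mul_mul_mul_comm, ← expect_mul_left]
  exact one_le_mul hw (le_expect _ fun y => hF _)

section Lookahead
variable (hR : m.RatioBound s₀ T L) (hB : m.BellmanBound s₀ T ε) (hL : 0 < L) (hε : 0 ≤ ε)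
include hR hB hL

theorem lookahead_le {r t : ℕ} (h : r + t ≤ T) (x : Pref S t) :
    m.lookahead s₀ r t x ≤ ENNReal.ofReal (1 + ε) ^ r := by
  induction r generalizing t with
  | zero => simp [lookahead]
  | succ r ih =>
    rw [pow_succ']
    exact pull_le hR hL (by omega) x (weight_le hR (by omega) hB x) fun y => ih (by omega) y

include hε in
theorem one_le_mul_lookahead {r t : ℕ} (h : r + t ≤ T) (x : Pref S t) :
    1 ≤ ENNReal.ofReal (1 + ε) ^ r * m.lookahead s₀ r t x := by
  induction r generalizing t with
  | zero => simp [lookahead]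
  | succ r ih =>
    rw [pow_succ']
    exact one_le_mul_pull hR hL (by omega) x (one_le_mul_weight hR (by omega) hL hε hB x)
      fun y => ih (by omega) y

end Lookahead

/-! ### Martingale and second-moment recursion for the accumulated weight -/

section Moments
variable {N : ℕ} [NeZero N]
  {κ : (t : ℕ) → (Fin N → Pref S t) → PMF ((Fin N → Pref S (t + 1)) × ℝ≥0∞)}

/-- `pull` maps each lookahead function to the preceding one, so weight times mean lookahead has
constant expectation. -/
theorem Unbiased.expect_lookahead (hκ : m.Unbiased s₀ T κ) {r t : ℕ} (h : r + t = T) :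
    expect (weightedLaw κ t) (fun p => p.2 * avg (m.lookahead s₀ r t) p.1) =
      m.lookahead s₀ T 0 PUnit.unit := by
  induction t generalizing r with
  | zero =>
    obtain rfl : r = T := h
    simp only [weightedLaw, expect_pure, one_mul]
    exact avg_const (N := N) (m.lookahead s₀ r 0 PUnit.unit) fun _ => PUnit.unit
  | succ t ih =>
    rw [expect_weightedLaw_succ, ← ih (r := r + 1) (by omega)]
    simp only [mul_assoc, expect_mul_left, hκ t (by omega : t < T)]
    rfl

theorem Unbiased.expect_weight (hκ : m.Unbiased s₀ T κ) :
    expect (weightedLaw κ T) (fun p => p.2) = m.lookahead s₀ T 0 PUnit.unit := by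
  rw [← hκ.expect_lookahead (zero_add T)]
  simp only [lookahead, avg_const, mul_one]

/-- Following the lookahead, and not the bare weight, leaves only the sampling noise `q` per round.
The Bellman error does not accumulate in the factor. -/
theorem expect_lookahead_sq_le {q : ℝ≥0∞}
    (hq : ∀ r t, r + 1 + t = T → ∀ x,
      expect (κ t x) (fun p => (p.2 * avg (m.lookahead s₀ r (t + 1)) p.1) ^ 2) ≤
        q * avg (m.lookahead s₀ (r + 1) t) x ^ 2) {r t : ℕ} (h : r + t = T) :
    expect (weightedLaw κ t) (fun p => (p.2 * avg (m.lookahead s₀ r t) p.1) ^ 2) ≤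
      q ^ t * m.lookahead s₀ T 0 PUnit.unit ^ 2 := by
  induction t generalizing r with
  | zero =>
    obtain rfl : r = T := h
    simp only [weightedLaw, expect_pure, one_mul, pow_zero]
    exact le_of_eq (congrArg (· ^ 2)
      (avg_const (N := N) (m.lookahead s₀ r 0 PUnit.unit) fun _ => PUnit.unit))
  | succ t ih =>
    rw [expect_weightedLaw_succ, pow_succ', mul_assoc]
    refine le_trans ?_ (mul_le_mul_right (ih (r := r + 1) (by omega)) q)
    rw [← expect_mul_left]
    refine expect_mono _ fun p => ?_
    simp only [mul_assoc, mul_pow p.2, expect_mul_left]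
    calc _ ≤ p.2 ^ 2 * (q * avg (m.lookahead s₀ (r + 1) t) p.1 ^ 2) := by
          gcongr
          exact hq r t (by omega) p.1
      _ = _ := by ring

end Moments

/-! ### The single-particle regime -/

section SmallBellman
variable {Nm : ℕ}

variable (m s₀ Nm) in
/-- The exact incremental weight of a single particle. -/
noncomputable def soleWeight (t : ℕ) (x : Fin 1 → Pref S t)
    (_mc : Fin 1 → Fin Nm → S (t + 1)) : ℝ≥0∞ := m.weight s₀ t (x 0)

/-- A single particle always resamples itself, so the Monte-Carlo estimates do not affect it. The
analysis may therefore attach the exact weight to it. -/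
theorem soleWeight_unbiased (hR : m.RatioBound s₀ T L) (hL : 0 < L) :
    m.Unbiased s₀ T (m.idealRound s₀ 1 Nm (m.soleWeight s₀ Nm)) := by
  intro t ht x F
  have hf : ∀ anc : Fin 1 → Fin 1, anc 0 = 0 := fun _ => Subsingleton.elim _ _
  rw [expect_idealRound]
  simp only [avg, soleWeight, Fin.sum_univ_one, hf, expect_const, Nat.cast_one, div_one]
  have := expect_indep_sum (n := 1) (fun i => m.optProposal s₀ t (x i))
    fun i y => m.weight s₀ t (x i) * F (x i, y)
  simp only [Fin.sum_univ_one] at this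
  rw [this, expect_mul_left, weight_mul_expect_optProposal hR ht hL]

/-- The bound holds surely, as each of the `t` factors is at least `lo`. A general monotone `f` lets
the induction absorb the last factor. -/
theorem le_expect_soleWeight {lo : ℝ≥0∞} (hlo : ∀ t < T, ∀ x : Pref S t, lo ≤ m.weight s₀ t x)
    {f : ℝ≥0∞ → ℝ≥0∞} (hf : Monotone f) {t : ℕ} (ht : t ≤ T) :
    f (lo ^ t) ≤ expect (weightedLaw (m.idealRound s₀ 1 Nm (m.soleWeight s₀ Nm)) t)
      fun p => f p.2 := by
  induction t generalizing f with
  | zero => simp [weightedLaw, expect_pure]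
  | succ t ih =>
    rw [expect_weightedLaw_succ, pow_succ]
    refine (ih (f := fun z => f (z * lo)) (fun a b h => hf (by gcongr))
      (Nat.le_of_succ_le ht)).trans (expect_mono _ fun p => ?_)
    rw [expect_idealRound]
    refine le_expect _ fun ys => le_expect _ fun mc => le_expect _ fun anc =>
      hf (mul_le_mul' le_rfl (hlo t ht _))

end SmallBellman

/-! ### Distance to the target -/

/-- Bernoulli's inequality: `(1 - δ') ^ (N T) ≥ 1 - δ' N T`, and the overlap `e` is at most `1`. -/
theorem one_le_overlap_add {e : ℝ≥0∞} (he : e ≤ 1) {d δ' : ℝ} (hd : 0 ≤ d) (hδ0 : 0 < δ')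
    (hδ1 : δ' ≤ 1) (N T : ℕ) (h : 1 ≤ e + ENNReal.ofReal d) :
    1 ≤ (ENNReal.ofReal (1 - δ') ^ N) ^ T * e + ENNReal.ofReal (d + δ' * (N * T)) := by
  rw [← pow_mul, ← ENNReal.ofReal_pow (by linarith)]
  set θ := (1 - δ') ^ (N * T) with hθ
  have hθ0 : 0 ≤ θ := pow_nonneg (by linarith) _
  have hθ1 : θ ≤ 1 := pow_le_one₀ (by linarith) (by linarith)
  have hber : 1 - θ ≤ δ' * (N * T) := by
    have := one_add_mul_le_pow (a := -δ') (by linarith) (N * T)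
    rw [← sub_eq_add_neg] at this
    push_cast at this
    linarith
  have hsplit : ENNReal.ofReal θ + ENNReal.ofReal (1 - θ) = 1 := by
    rw [← ENNReal.ofReal_add hθ0 (by linarith)]; simp
  calc 1 ≤ (ENNReal.ofReal θ + ENNReal.ofReal (1 - θ)) * e + ENNReal.ofReal d := by
        rwa [hsplit, one_mul]
    _ = ENNReal.ofReal θ * e + (ENNReal.ofReal d + ENNReal.ofReal (1 - θ) * e) := by ring
    _ ≤ ENNReal.ofReal θ * e + (ENNReal.ofReal d + ENNReal.ofReal (δ' * (N * T)) * 1) := by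
        gcongr
    _ = _ := by rw [mul_one, ← ENNReal.ofReal_add hd (by positivity)]

theorem lookahead_ne_top (hR : m.RatioBound s₀ T L) (hB : m.BellmanBound s₀ T ε) (hL : 0 < L) :
    m.lookahead s₀ T 0 PUnit.unit ≠ ∞ :=
  ne_top_of_le_ne_top (ENNReal.pow_ne_top ENNReal.ofReal_ne_top)
    (lookahead_le hR hB hL (r := T) (t := 0) le_rfl PUnit.unit)

theorem lookahead_ne_zero (hR : m.RatioBound s₀ T L) (hB : m.BellmanBound s₀ T ε) (hL : 0 < L)
    (hε : 0 ≤ ε) : m.lookahead s₀ T 0 PUnit.unit ≠ 0 := fun h => by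
  have := one_le_mul_lookahead hR hB hL hε (r := T) (t := 0) le_rfl PUnit.unit
  rw [h, mul_zero] at this
  exact absurd this (by simp)

/-- With one particle the error is at most `2 ε T`, up to the failures of rejection sampling. -/
theorem tvDist_le_of_small (hR : m.RatioBound s₀ T L) (hB : m.BellmanBound s₀ T ε) (hL : 0 < L)
    (hε : 0 ≤ ε) {a : ℝ} (hεa : ε ≤ a) {δ' : ℝ} (hδ0 : 0 < δ') (hδ1 : δ' ≤ 1) (Nm : ℕ) :
    tvDist (m.target s₀ T) ((m.smc s₀ T 1 Nm (4 * (L * (1 + a))) δ').map Run.out) ≤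
      2 * (ε * T) + δ' * ((1 : ℕ) * T) := by
  have hub := soleWeight_unbiased (Nm := Nm) hR hL
  set Z := m.lookahead s₀ T 0 PUnit.unit with hZ
  set B := ENNReal.ofReal (1 + ε) with hBdef
  have hB0 : B ≠ 0 := (ENNReal.ofReal_pos.2 (by linarith)).ne'
  have hB1 : B ≠ ∞ := ENNReal.ofReal_ne_top
  have hlo : ∀ t < T, ∀ x : Pref S t, B⁻¹ ≤ m.weight s₀ t x := fun t ht x => by
    calc B⁻¹ = B⁻¹ * 1 := (mul_one _).symm
      _ ≤ B⁻¹ * (B * m.weight s₀ t x) := by gcongr; exact one_le_mul_weight hR ht hL hε hB x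
      _ = _ := by rw [← mul_assoc, ENNReal.inv_mul_cancel hB0 hB1, one_mul]
  refine tvDist_target_smc_le hR hub (by positivity)
    (pow_le_one₀ bot_le (ENNReal.ofReal_le_one.2 (by linarith)))
    (fun t ht x f => idealRound_dominated hR hB hL hε hεa hδ0 hδ1 ht x f)
    hub.expect_weight (lookahead_ne_zero hR hB hL hε) (lookahead_ne_top hR hB hL)
    (one_le_overlap_add (expect_le _ fun _ => min_le_right _ _) (by positivity) hδ0 hδ1 1 T ?_)
  have hmono : Monotone fun z : ℝ≥0∞ => min (z / Z) 1 := fun x y h => by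
    dsimp only; gcongr
  refine le_trans ?_ (add_le_add_left (le_expect_soleWeight hlo hmono le_rfl) _)
  have hinv : B⁻¹ = ENNReal.ofReal (1 + ε)⁻¹ := (ENNReal.ofReal_inv_of_pos (by linarith)).symm
  -- The numerator is at least `(1 + ε) ^ (-T)`, `Z` is at most `(1 + ε) ^ T`, and Bernoulli's
  -- inequality applies to the power `2 T`.
  have hratio : ENNReal.ofReal (1 - 2 * (ε * T)) ≤ B⁻¹ ^ T / Z := by
    calc ENNReal.ofReal (1 - 2 * (ε * T)) ≤ ENNReal.ofReal ((1 + ε)⁻¹ ^ (2 * T)) := by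
          refine ENNReal.ofReal_le_ofReal ?_
          have h1 : (1 + ε)⁻¹ = 1 + -(ε / (1 + ε)) := by field_simp; ring
          have h2 : ε / (1 + ε) ≤ ε := div_le_self hε (by linarith)
          have h3 : ε / (1 + ε) ≤ 1 := (div_le_one (by linarith)).2 (by linarith)
          have := one_add_mul_le_pow (a := -(ε / (1 + ε))) (by linarith) (2 * T)
          rw [← h1] at this
          refine le_trans ?_ this
          push_cast
          nlinarith [mul_le_mul_of_nonneg_left h2 (Nat.cast_nonneg (α := ℝ) T)]
      _ = B⁻¹ ^ T / B ^ T := by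
          rw [ENNReal.ofReal_pow (by positivity), ← hinv, ENNReal.div_eq_inv_mul,
            ENNReal.inv_pow, ← pow_add, two_mul]
      _ ≤ B⁻¹ ^ T / Z := by
          gcongr
          exact lookahead_le hR hB hL (r := T) (t := 0) le_rfl PUnit.unit
  calc 1 ≤ ENNReal.ofReal (1 - 2 * (ε * T)) + ENNReal.ofReal (2 * (ε * T)) := by
        rw [← ENNReal.ofReal_one]
        refine le_trans (ENNReal.ofReal_le_ofReal ?_) ENNReal.ofReal_add_le
        linarith
    _ ≤ _ := by
        gcongr
        refine le_min hratio (ENNReal.ofReal_le_one.2 ?_)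
        have : 0 ≤ ε * T := by positivity
        linarith

theorem one_add_pow_le {u : ℝ} (hu : 0 ≤ u) (T : ℕ) (h : u * T ≤ 1) :
    (1 + u) ^ T ≤ 1 + 2 * (u * T) := by
  have h0 : 0 ≤ u * T := by positivity
  have h1 := Real.abs_exp_sub_one_sub_id_le (x := u * T) (by rwa [abs_of_nonneg h0])
  calc (1 + u) ^ T ≤ Real.exp u ^ T := by
        gcongr
        linarith [Real.add_one_le_exp u]
    _ = Real.exp (u * T) := by rw [← Real.exp_nat_mul, mul_comm]
    _ ≤ _ := by nlinarith [abs_le.1 h1]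

/-- With `N` particles and at least `L` Monte-Carlo samples the error is `O(√(T / N))`, up to the
failures of rejection sampling. -/
theorem tvDist_le_of_large (hR : m.RatioBound s₀ T L) (hB : m.BellmanBound s₀ T ε) (hL : 0 < L)
    (hε : 0 ≤ ε) {a b : ℝ} (hεa : ε ≤ a) (hT : 1 ≤ T) (hb : (1 + ε) ^ T ≤ b) {δ' : ℝ}
    (hδ0 : 0 < δ') (hδ1 : δ' ≤ 1) (N Nm : ℕ) [NeZero N] (hNm : 0 < Nm) (hLN : L ≤ Nm) {l : ℝ}
    (hl : 0 < l) (hN1 : 7 * b ^ 12 * T ≤ N) (hN2 : 14 * b ^ 12 * T ≤ l ^ 2 * N) :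
    tvDist (m.target s₀ T) ((m.smc s₀ T N Nm (4 * (L * (1 + a))) δ').map Run.out) ≤
      l / 2 + δ' * (N * T) := by
  have hub := meanWeight_unbiased (N := N) hR hL hNm
  have hZ0 := lookahead_ne_zero hR hB hL hε
  have hZ1 := lookahead_ne_top hR hB hL
  set Z := m.lookahead s₀ T 0 PUnit.unit with hZ
  have hN : (0 : ℝ) < N := by exact_mod_cast NeZero.pos N
  have hb1 : 1 ≤ b := (one_le_pow₀ (by linarith)).trans hb
  have hpow : ∀ r ≤ T, ENNReal.ofReal (1 + ε) ^ r ≤ ENNReal.ofReal b := fun r hr => by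
    rw [← ENNReal.ofReal_pow (by linarith)]
    exact ENNReal.ofReal_le_ofReal ((pow_le_pow_right₀ (by linarith) hr).trans hb)
  have hone : ENNReal.ofReal (1 + ε) ≤ ENNReal.ofReal b := by simpa using hpow 1 hT
  set q : ℝ≥0∞ := 1 + 7 * ENNReal.ofReal b ^ 12 / N with hq
  have hstep : ∀ r t, r + 1 + t = T → ∀ x,
      expect (m.idealRound s₀ N Nm (m.meanWeight s₀) t x)
        (fun p => (p.2 * avg (m.lookahead s₀ r (t + 1)) p.1) ^ 2) ≤
        q * avg (m.lookahead s₀ (r + 1) t) x ^ 2 := fun r t h x =>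
    expect_meanWeight_sq_le hR hL hNm hLN (ENNReal.one_le_ofReal.2 hb1) (by omega)
      (fun x => (weight_le hR (by omega) hB x).trans hone)
      (fun x => (one_le_mul_weight hR (by omega) hL hε hB x).trans (by gcongr))
      (fun x => (lookahead_le hR hB hL (r := r) (by omega) x).trans (hpow r (by omega)))
      (fun x => (one_le_mul_lookahead hR hB hL hε (r := r) (by omega) x).trans (by
        gcongr; exact hpow r (by omega))) x
  have hsq := expect_lookahead_sq_le hstep (zero_add T)
  simp only [lookahead, avg_const, mul_one] at hsq
  -- `hN1` makes `T` times the per-round increment at most `1`, where the power is at most `1` plus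
  -- twice that product; hence `14 = 2 · 7`.
  have hqT : q ^ T ≤ ENNReal.ofReal (1 + 14 * b ^ 12 * T / N) := by
    have hq' : q = ENNReal.ofReal (1 + 7 * b ^ 12 / N) := by
      rw [hq, ENNReal.ofReal_add zero_le_one (by positivity), ENNReal.ofReal_one,
        ENNReal.ofReal_div_of_pos hN, ENNReal.ofReal_mul (by norm_num), ENNReal.ofReal_natCast,
        ENNReal.ofReal_pow (by linarith)]
      norm_num
    rw [hq', ← ENNReal.ofReal_pow (by positivity)]
    refine ENNReal.ofReal_le_ofReal ((one_add_pow_le (by positivity) T ?_).trans_eq (by ring))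
    rwa [div_mul_eq_mul_div, div_le_one hN]
  refine tvDist_target_smc_le hR hub (by positivity)
    (pow_le_one₀ bot_le (ENNReal.ofReal_le_one.2 (by linarith)))
    (fun t ht x f => idealRound_dominated hR hB hL hε hεa hδ0 hδ1 ht x f)
    hub.expect_weight hZ0 hZ1
    (one_le_overlap_add (expect_le _ fun _ => min_le_right _ _) (by positivity) hδ0 hδ1 N T ?_)
  refine one_le_expect_min_add _ _ (η := 14 * b ^ 12 * T / N) hl (by positivity)
    (by rwa [div_le_iff₀ hN]) ?_ ?_
  · simp only [ENNReal.div_eq_inv_mul, expect_mul_left, hub.expect_weight]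
    exact ENNReal.inv_mul_cancel hZ0 hZ1
  · simp only [ENNReal.div_eq_inv_mul, mul_pow, expect_mul_left]
    calc _ ≤ Z⁻¹ ^ 2 * (q ^ T * Z ^ 2) := by gcongr
      _ = q ^ T * (Z⁻¹ * Z) ^ 2 := by ring
      _ = q ^ T := by rw [ENNReal.inv_mul_cancel hZ0 hZ1, one_pow, mul_one]
      _ ≤ _ := hqT

end Model

/-! ### Running time -/

theorem histTime_le {S : ℕ → Type u} {N Nm n : ℕ} (t : ℕ) (h : Hist S N Nm n t) :
    histTime t h ≤ t * (N * (5 * n + 2 * Nm + 4)) := by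
  induction t with
  | zero => exact Nat.zero_le _
  | succ t ih =>
    obtain ⟨h, r⟩ := h
    have h1 : ∑ i, (r.rs i).time ≤ N * (5 * n + 1) :=
      (Finset.sum_le_sum fun i _ => (r.rs i).time_le).trans_eq (by simp)
    have h2 := ih h
    calc histTime t h + r.time
        ≤ t * (N * (5 * n + 2 * Nm + 4)) + (N * (5 * n + 1) + N * (2 * Nm + 2) + N) := by
          unfold Round.time; gcongr
      _ = _ := by ring

theorem Run.time_le {S : ℕ → Type u} {T N Nm n : ℕ} (ω : Run S T N Nm n) :
    ω.time ≤ T * N * (5 * n + 2 * Nm + 4) + 1 := by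
  rw [Run.time, mul_assoc]
  exact Nat.succ_le_succ (histTime_le T ω.1)

theorem filter_univ {α : Type*} (p : PMF α) (h : ∃ a ∈ Set.univ, a ∈ p.support) :
    p.filter Set.univ h = p := by
  ext a
  rw [PMF.filter_apply]
  simp [p.tsum_coe]

theorem toOuterMeasure_univ {α : Type*} (p : PMF α) : p.toOuterMeasure Set.univ = 1 := by
  rw [PMF.toOuterMeasure_apply, Set.indicator_univ, p.tsum_coe]

/-- If the number of particle updates `N T` is polynomial in `T / δTV`, then a run takes time
`O(N T L)` up to logarithmic factors. -/
theorem time_bound {c K A L R δ : ℝ} {T N Nm : ℕ} (hc : 0 ≤ c) (hK : 1 ≤ K) (hA : 1 ≤ A)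
    (hL : 1 ≤ L) (hR : 0 ≤ R) (hδ0 : 0 < δ) (hδ1 : δ ≤ 1 / 2) (hT : 1 ≤ T) (hN : 1 ≤ N)
    (hNm : (Nm : ℝ) ≤ L + 1) (hNT : (N : ℝ) * T ≤ A * (1 + R) ^ 3) :
    (T : ℝ) * N * (5 * rsBudget (4 * (L * (1 + c))) (δ / (K * N * T)) + 2 * Nm + 4) + 1 ≤
      (80 * (1 + c) * (2 * (Real.log (4 * K * A) + 3) + 1) + 28) * (N * T) *
        (L * ((1 + Real.log (1 + R)) * Real.log (1 / δ))) := by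
  have hT' : (1 : ℝ) ≤ T := by exact_mod_cast hT
  have hN' : (1 : ℝ) ≤ N := by exact_mod_cast hN
  have hNT1 : (1 : ℝ) ≤ N * T := one_le_mul_of_one_le_of_one_le hN' hT'
  set r := Real.log (1 + R) with hr
  have hr0 : 0 ≤ r := Real.log_nonneg (by linarith)
  set l := Real.log (1 / δ) with hl
  have hl2 : 1 / 2 ≤ l := by
    have h1 : Real.log 2 ≤ l := Real.log_le_log two_pos (by rw [le_div_iff₀ hδ0]; linarith)
    linarith [Real.log_two_gt_d9]
  set G := Real.log (4 * K * A) + 3 with hG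
  have hKA : 1 ≤ K * A := one_le_mul_of_one_le_of_one_le hK hA
  have hG0 : 0 ≤ Real.log (4 * K * A) := Real.log_nonneg (by nlinarith)
  -- `4 / δ' = 4 K N T / δ`, and `N T` is polynomial in `1 + R`, so the failure probability enters
  -- only through `log (1 + R)` and `log (1 / δ)`.
  have hlog : Real.log (4 / (δ / (K * N * T))) ≤ G * (1 + r) + l := by
    have e : 4 / (δ / (K * N * T)) = 4 * K * (N * T) * (1 / δ) := by
      field_simp
    have h1 : Real.log (4 * K * (N * T)) ≤ Real.log (4 * K * A * (1 + R) ^ 3) :=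
      Real.log_le_log (by positivity) (by
        rw [mul_assoc (4 * K)]; exact mul_le_mul_of_nonneg_left hNT (by positivity))
    rw [Real.log_mul (x := 4 * K * A) (by positivity) (by positivity), Real.log_pow] at h1
    rw [e, Real.log_mul (by positivity) (by positivity), hG]
    push_cast at h1
    nlinarith [mul_nonneg hG0 hr0]
  set P := (1 + r) * l with hP
  have hP2 : 1 / 2 ≤ P := by nlinarith
  have hlog' : Real.log (4 / (δ / (K * N * T))) ≤ (2 * G + 1) * P := by
    refine hlog.trans ?_
    have h1 : 0 ≤ G * (1 + r) := by positivity
    nlinarith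
  have hLP : 1 / 2 ≤ L * P := by nlinarith
  have hlogpos : 0 ≤ Real.log (4 / (δ / (K * N * T))) := by
    refine Real.log_nonneg ?_
    rw [div_div_eq_mul_div, le_div_iff₀ hδ0]
    nlinarith [one_le_mul_of_one_le_of_one_le hK hNT1]
  have hn : (rsBudget (4 * (L * (1 + c))) (δ / (K * N * T)) : ℝ) ≤
      16 * (1 + c) * (2 * G + 1) * (L * P) + 1 := by
    refine (Nat.ceil_lt_add_one (by positivity)).le.trans ?_
    have := mul_le_mul_of_nonneg_left hlog' (show 0 ≤ 4 * (4 * (L * (1 + c))) by positivity)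
    linarith
  have hLLP : L ≤ 2 * (L * P) := by nlinarith
  have hround : (5 * rsBudget (4 * (L * (1 + c))) (δ / (K * N * T)) + 2 * Nm + 4 : ℝ) ≤
      (80 * (1 + c) * (2 * G + 1) + 26) * (L * P) := by linarith
  calc _ ≤ (T : ℝ) * N * ((80 * (1 + c) * (2 * G + 1) + 26) * (L * P)) +
        (N * T) * (2 * (L * P)) := by
        gcongr
        nlinarith
    _ = _ := by ring

/-- The number of particles needed when the Bellman error is not negligible. -/
theorem exists_particle_number {A c d : ℝ} {T : ℕ} (hA : 0 < A) (hT : 1 ≤ T) (hd : 0 < d)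
    (hdc : d ≤ c) : ∃ N : ℕ, 0 < N ∧ A * T ≤ N ∧ A * T ≤ d ^ 2 * N ∧
      (N : ℝ) * T ≤ (A * (c ^ 2 + 1) + c ^ 2) * (T / d) ^ 2 := by
  have hT' : (1 : ℝ) ≤ T := by exact_mod_cast hT
  have hle := Nat.le_ceil (A * T * (1 + 1 / d ^ 2))
  have h0 : 0 ≤ A * T * (1 / d ^ 2) := by positivity
  have h1 : 0 ≤ A * T := by positivity
  -- The summands `1` and `1 / d ^ 2` serve the two lower bounds on `N`; `d ≤ c` absorbs the `1` and
  -- the rounding.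
  refine ⟨⌈A * T * (1 + 1 / d ^ 2)⌉₊, Nat.ceil_pos.2 (by positivity), by linarith, ?_, ?_⟩
  · calc A * T = d ^ 2 * (A * T * (1 / d ^ 2)) := by field_simp
      _ ≤ _ := by gcongr; linarith
  · have hcd : 1 ≤ c ^ 2 / d ^ 2 := by
      rw [le_div_iff₀ (by positivity), one_mul]; gcongr
    calc _ ≤ (A * T * (1 + 1 / d ^ 2) + 1) * T := by
          gcongr
          exact (Nat.ceil_lt_add_one (by positivity)).le
      _ ≤ (A * T * (c ^ 2 / d ^ 2 + 1 / d ^ 2) + T * (c ^ 2 / d ^ 2)) * T := by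
          gcongr
          exact one_le_mul_of_one_le_of_one_le hT' hcd
      _ = _ := by ring

/-- The choice of the number of particles: one if the Bellman error is negligible, and of order
`T / δTV ^ 2` otherwise. -/
theorem exists_size_tvDist_le {c₁ c₂ b A ε L δTV : ℝ} {T : ℕ} (hc₂ : 0 < c₂) (hT : 1 ≤ T)
    (hε : 0 ≤ ε) (hεT : ε * T ≤ c₁) (hL : 0 < L) (hδ : 0 < δTV) (hδc : δTV ≤ c₂)
    (hb : b = Real.exp c₁) (hA : A = 14 * b ^ 12 * (c₂ ^ 2 + 1) + c₂ ^ 2) :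
    ∃ (N : ℕ) (_ : NeZero N), (N : ℝ) * T ≤ (1 + A + c₂) * (1 + T / δTV) ^ 3 ∧
      (N : ℝ) * T ≤ (1 + 4 * A) * (ε * T ^ 5 / δTV ^ 3 + T) ∧
      ∀ (S : ℕ → Type u) (m : Model S) (s₀ : S 0),
        m.RatioBound s₀ T L → m.BellmanBound s₀ T ε → ∀ δ' : ℝ, 0 < δ' → δ' ≤ 1 →
        tvDist (m.target s₀ T)
          ((m.smc s₀ T N ⌈L⌉₊ (4 * (L * (1 + c₁))) δ').map Run.out) ≤
          δTV / 2 + δ' * (N * T) := by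
  have hb0 : 0 < b := hb ▸ Real.exp_pos _
  have hA0 : 0 < A := by rw [hA]; positivity
  have hT' : (1 : ℝ) ≤ T := by exact_mod_cast hT
  have hεc : ε ≤ c₁ := (le_mul_of_one_le_right hε hT').trans hεT
  have hR0 : (0 : ℝ) ≤ T / δTV := by positivity
  have hR3 : 0 ≤ (1 + T / δTV) ^ 3 := by positivity
  -- The cutoff `δTV / 4` makes the single-particle error `2 ε T` at most `δTV / 2`.
  rcases le_or_gt (ε * T) (δTV / 4) with hsmall | hlarge
  · refine ⟨1, inferInstance, ?_, ?_, fun S m s₀ hR hB δ' hδ0 hδ1 => ?_⟩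
    · have hTR : (T : ℝ) ≤ c₂ * (T / δTV) := by
        rw [mul_div_assoc', le_div_iff₀ hδ]; nlinarith
      have h1 : T / δTV ≤ (1 + T / δTV) ^ 3 := by nlinarith [pow_nonneg hR0 2, pow_nonneg hR0 3]
      have h2 := mul_le_mul_of_nonneg_left h1 hc₂.le
      have h3 := mul_nonneg hA0.le hR3
      push_cast
      linarith
    · have h1 : 0 ≤ ε * T ^ 5 / δTV ^ 3 := by positivity
      have h2 : 0 ≤ A * (ε * T ^ 5 / δTV ^ 3 + T) := by positivity
      push_cast
      linarith
    · refine (Model.tvDist_le_of_small hR hB hL hε hεc hδ0 hδ1 ⌈L⌉₊).trans ?_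
      gcongr
      linarith
  · obtain ⟨N, hN0, hN1, hN2, hN3⟩ :=
      exists_particle_number (A := 14 * b ^ 12) (by positivity) hT hδ hδc
    rw [← hA] at hN3
    have : NeZero N := ⟨hN0.ne'⟩
    refine ⟨N, this, ?_, ?_, fun S m s₀ hR hB δ' hδ0 hδ1 => ?_⟩
    · have h1 : (T / δTV) ^ 2 ≤ (1 + T / δTV) ^ 3 := by
        nlinarith [pow_nonneg hR0 2, pow_nonneg hR0 3]
      have h2 := mul_le_mul_of_nonneg_left h1 hA0.le
      have h3 := mul_nonneg hc₂.le hR3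
      linarith
    · have h1 : (T / δTV) ^ 2 ≤ 4 * (ε * T ^ 5 / δTV ^ 3) := by
        rw [div_pow, mul_div_assoc', div_le_div_iff₀ (by positivity) (by positivity)]
        have h4 : (T : ℝ) ^ 2 * 1 ≤ T ^ 2 * T ^ 2 := by gcongr; exact one_le_pow₀ hT'
        calc (T : ℝ) ^ 2 * δTV ^ 3 = T ^ 2 * 1 * δTV ^ 2 * δTV := by ring
          _ ≤ T ^ 2 * T ^ 2 * δTV ^ 2 * (4 * (ε * T)) := by gcongr; linarith
          _ = _ := by ring
      have h2 := mul_le_mul_of_nonneg_left h1 hA0.le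
      have h3 : 0 ≤ ε * T ^ 5 / δTV ^ 3 := by positivity
      have h4 : 0 ≤ A * T := by positivity
      linarith
    · have hbpow : (1 + ε) ^ T ≤ b := by
        calc (1 + ε) ^ T ≤ Real.exp ε ^ T := by
              gcongr
              linarith [Real.add_one_le_exp ε]
          _ = Real.exp (ε * T) := by rw [← Real.exp_nat_mul, mul_comm]
          _ ≤ b := hb ▸ Real.exp_le_exp.2 hεT
      refine Model.tvDist_le_of_large hR hB hL hε hεc hT hbpow hδ0 hδ1 N ⌈L⌉₊
        (Nat.ceil_pos.2 hL) (Nat.le_ceil L) hδ ?_ hN2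
      refine le_trans ?_ hN1
      gcongr
      norm_num

end OptSMC

/-! ### The main theorem: choice of constants -/

theorem mainTheorem9 :
    ∀ c₁ c₂ c₃ : ℝ, 0 < c₁ → 0 < c₂ → 0 < c₃ →
    ∃ (C K : ℝ) (k : ℕ), 0 < C ∧ 1 ≤ K ∧
    ∀ (T : ℕ) (ε L δTV δ : ℝ), 1 ≤ T → 0 ≤ ε → ε ≤ c₁ / T → 1 ≤ L →
      0 < δTV → δTV ≤ c₂ → 0 < δ → δ ≤ c₃ * δTV → δ ≤ 1 / 2 →
    ∃ (N Nm : ℕ) (M : ℝ) (_ : NeZero N), 0 < Nm ∧ 0 < M ∧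
    ∀ (S : ℕ → Type u) (m : OptSMC.Model S) (s₀ : S 0),
      m.RatioBound s₀ T L → m.BellmanBound s₀ T ε →
      (∀ ω : OptSMC.Run S T N Nm (OptSMC.rsBudget M (δ / (K * N * T))),
        (OptSMC.Run.time ω : ℝ) ≤
          C * (1 + Real.log (1 + T / δTV)) ^ k *
            ((ε * L * T ^ 5 / δTV ^ 3 + L * T) * Real.log (1 / δ))) ∧
      ∃ (E : Set (OptSMC.Run S T N Nm (OptSMC.rsBudget M (δ / (K * N * T)))))
        (hE : ∃ ω ∈ E, ω ∈ (m.smc s₀ T N Nm M (δ / (K * N * T))).support),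
        1 - δ ≤ ((m.smc s₀ T N Nm M (δ / (K * N * T))).toOuterMeasure E).toReal ∧
        OptSMC.tvDist (m.target s₀ T)
          (((m.smc s₀ T N Nm M (δ / (K * N * T))).filter E hE).map OptSMC.Run.out) ≤ δTV := by
  intro c₁ c₂ c₃ hc₁ hc₂ hc₃
  obtain ⟨b, hb⟩ : ∃ b, b = Real.exp c₁ := ⟨_, rfl⟩
  have hb0 : 0 < b := hb ▸ Real.exp_pos _
  obtain ⟨A', hA'⟩ : ∃ A', A' = 14 * b ^ 12 * (c₂ ^ 2 + 1) + c₂ ^ 2 := ⟨_, rfl⟩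
  have hA'0 : 0 < A' := by rw [hA']; positivity
  -- With this `K`, `δ ≤ c₃ δTV` gives `δ / K ≤ δTV / 2`, the half of the error budget left for
  -- rejection-sampling failures.
  obtain ⟨K, hK⟩ : ∃ K, K = 1 + 2 * c₃ := ⟨_, rfl⟩
  have hK1 : 1 ≤ K := by linarith
  have hA''1 : 1 ≤ 1 + A' + c₂ := by linarith
  obtain ⟨H, hH⟩ : ∃ H, H =
      80 * (1 + c₁) * (2 * (Real.log (4 * K * (1 + A' + c₂)) + 3) + 1) + 28 :=
    ⟨_, rfl⟩
  have hlogKA : 0 ≤ Real.log (4 * K * (1 + A' + c₂)) :=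
    Real.log_nonneg (by nlinarith [one_le_mul_of_one_le_of_one_le hK1 hA''1])
  have hH0 : 0 < H := by rw [hH]; positivity
  refine ⟨H * (1 + 4 * A'), K, 1, by positivity, hK1, ?_⟩
  intro T ε L δTV δ hT hε hεT hL hδTV hδTV₂ hδ hδ₃ hδ1
  have hL0 : 0 < L := by linarith
  have hεT' : ε * T ≤ c₁ := (le_div_iff₀ (by exact_mod_cast hT)).1 hεT
  have hfail : δ / K ≤ δTV / 2 := by
    rw [div_le_iff₀ (by linarith), hK]
    nlinarith
  obtain ⟨N, hNz, hNT3, hNT, htv⟩ :=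
    OptSMC.exists_size_tvDist_le.{u} hc₂ hT hε hεT' hL0 hδTV hδTV₂ hb hA'
  have hN1 : 1 ≤ N := NeZero.one_le
  have hKNT : 1 ≤ K * N * T :=
    one_le_mul_of_one_le_of_one_le (one_le_mul_of_one_le_of_one_le hK1 (by exact_mod_cast hN1))
      (by exact_mod_cast hT)
  obtain ⟨δ', hδ'⟩ : ∃ δ', δ' = δ / (K * N * T) := ⟨_, rfl⟩
  have hδ'0 : 0 < δ' := by rw [hδ']; positivity
  have hδ'1 : δ' ≤ 1 := by rw [hδ', div_le_one (by linarith)]; linarith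
  have hδ'2 : δ' * (N * T) = δ / K := by
    have : (N : ℝ) ≠ 0 := Nat.cast_ne_zero.2 (NeZero.ne N)
    rw [hδ']; field_simp
  have hbound := OptSMC.time_bound (Nm := ⌈L⌉₊) hc₁.le hK1 hA''1 hL
    (show (0 : ℝ) ≤ T / δTV by positivity) hδ hδ1 hT hN1 (Nat.ceil_lt_add_one hL0.le).le hNT3
  refine ⟨N, ⌈L⌉₊, 4 * (L * (1 + c₁)), hNz, Nat.ceil_pos.2 hL0, by positivity, ?_⟩
  rw [← hδ', ← hH] at hbound
  rw [← hδ']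
  intro S m s₀ hR hB
  -- The error bound holds for the unconditional output law: a failure of rejection sampling costs
  -- at most `δ / K ≤ δTV / 2` in total variation. Hence the event can be the sure one.
  refine ⟨fun ω => ?_, Set.univ, ?_, ?_, ?_⟩
  · have h1 : (OptSMC.Run.time ω : ℝ) ≤ T * N * (5 * OptSMC.rsBudget (4 * (L * (1 + c₁))) δ' +
        2 * ⌈L⌉₊ + 4) + 1 := by exact_mod_cast OptSMC.Run.time_le ω
    refine h1.trans (hbound.trans ?_)
    have hlogR : 0 ≤ Real.log (1 + T / δTV) :=
      Real.log_nonneg (le_add_of_nonneg_right (by positivity))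
    have hlogδ : 0 ≤ Real.log (1 / δ) := Real.log_nonneg (by rw [le_div_iff₀ hδ]; linarith)
    calc H * (N * T) * (L * ((1 + Real.log (1 + T / δTV)) * Real.log (1 / δ)))
        ≤ H * ((1 + 4 * A') * (ε * T ^ 5 / δTV ^ 3 + T)) *
          (L * ((1 + Real.log (1 + T / δTV)) * Real.log (1 / δ))) := by gcongr
      _ = _ := by ring
  · obtain ⟨ω, hω⟩ := (m.smc s₀ T N ⌈L⌉₊ (4 * (L * (1 + c₁))) δ').support_nonempty
    exact ⟨ω, Set.mem_univ _, hω⟩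
  · rw [OptSMC.toOuterMeasure_univ, ENNReal.toReal_one]
    linarith
  · rw [OptSMC.filter_univ]
    refine (htv S m s₀ hR hB δ' hδ'0 hδ'1).trans ?_
    linarith
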